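/- Let $n\ge 2$ and $m\ge 3$ be integers and let $K$ be a field containing a primitive $m$-th root of unity $q$. All algebras, Hopf algebras, Hopf algebra maps and tensor products are over $K$. Let $U_n(K)=\{\omega\in K : \omega^n=1\}$, let $K[C_n]$ be the group Hopf algebra of the cyclic group $C_n$ of order $n$, and let $T_{m^2}(q)$ be the Taft Hopf algebra, i.e. the algebra generated by $h,x$ subject to $h^m=1$, $x^m=0$, $xh=qhx$, with $$\Delta(h)=h\otimes h,\quad \Delta(x)=x\otimes h+1\otimes x,\quad \varepsilon(h)=1,\quad \varepsilon(x)=0,\quad S(h)=h^{-1},\quad S(x)=-xh^{-1}.$$ A Hopf algebra $E$ is said to factorize through Hopf algebras $A$ and $H$ if there are injective Hopf algebra maps $i\colon A\to E$ and $j\colon H\to E$ such that the linear map $A\otimes H\to E$, $a\otimes y\mapsto i(a)j(y)$, is bijective. For $\omega\in U_n(K)$ let $T^{\omega}_{nm^2}(q)$ be the Hopf algebra generated as an algebra by $g,h,x$ subject to the relations $$g^n=h^m=1,\quad x^m=0,\quad xh=qhx,\quad hg=gh,\quad gx=\omega xg,$$ with coalgebra structure and antipode given by $$\Delta(g)=g\otimes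 g,\quad \Delta(h)=h\otimes h,\quad \Delta(x)=x\otimes h+1\otimes x,\quad \varepsilon(g)=\varepsilon(h)=1,\quad \varepsilon(x)=0,$$ $$S(g)=g^{n-1},\quad S(h)=h^{m-1},\quad S(x)=-xh^{m-1}.$$ Then a Hopf algebra $E$ factorizes through $T_{m^2}(q)$ and $K[C_n]$ if and only if $E\cong T^{\omega}_{nm^2}(q)$ as Hopf algebras for some $\omega\in U_n(K)$. -/

import Mathlib

open scoped TensorProduct

noncomputable section

/-- A Hopf algebra `E` factorizes through the Hopf algebras `A` and `H` if there are injective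
Hopf algebra maps `i : A → E` and `j : H → E` such that the linear map
`A ⊗ H → E`, `a ⊗ y ↦ i a * j y`, is bijective. -/
def FactorizesThrough (K E A H : Type*) [Field K] [Ring E] [Ring A] [Ring H]
    [HopfAlgebra K E] [HopfAlgebra K A] [HopfAlgebra K H] : Prop :=
  ∃ (i : A →ₐc[K] E) (j : H →ₐc[K] E), Function.Injective i ∧ Function.Injective j ∧
    Function.Bijective
      (LinearMap.mul' K E ∘ₗ
        TensorProduct.map (i : A →ₐ[K] E).toLinearMap (j : H →ₐ[K] E).toLinearMap)

/-! ### Powers of sums of `q`-commuting elements -/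

namespace QBinomial

/-- Gaussian binomial coefficients, evaluated at `q`. -/
def coeff {K : Type*} [Field K] (q : K) : ℕ → ℕ → K
  | _, 0 => 1
  | 0, _ + 1 => 0
  | n + 1, k + 1 => coeff q n k + q ^ (k + 1) * coeff q n (k + 1)

variable {K : Type*} [Field K] (q : K)

lemma coeff_zero_right (n : ℕ) : coeff q n 0 = 1 := by cases n <;> rfl

lemma coeff_succ_succ (n k : ℕ) :
    coeff q (n + 1) (k + 1) = coeff q n k + q ^ (k + 1) * coeff q n (k + 1) := rfl

lemma coeff_eq_zero : ∀ {n k : ℕ}, n < k → coeff q n k = 0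
  | 0, _ + 1, _ => rfl
  | n + 1, k + 1, h => by
    rw [coeff_succ_succ, coeff_eq_zero (by omega), coeff_eq_zero (by omega)]; ring

lemma coeff_self : ∀ n : ℕ, coeff q n n = 1
  | 0 => rfl
  | n + 1 => by rw [coeff_succ_succ, coeff_self n, coeff_eq_zero q (by omega)]; ring

lemma pow_sub_one_mul_coeff : ∀ n k : ℕ,
    (q ^ (k + 1) - 1) * coeff q (n + 1) (k + 1) = (q ^ (n + 1) - 1) * coeff q n k
  | 0, 0 => by simp [coeff]
  | 0, k + 1 => by simp [coeff]
  | n + 1, 0 => by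
    have h := pow_sub_one_mul_coeff n 0
    rw [coeff_zero_right] at h
    rw [coeff_succ_succ, coeff_zero_right, mul_add, mul_left_comm, h]
    ring
  | n + 1, k + 1 => by
    have h₁ := pow_sub_one_mul_coeff n k
    have h₂ := pow_sub_one_mul_coeff n (k + 1)
    have h₃ := coeff_succ_succ q n k
    rw [coeff_succ_succ q (n + 1) (k + 1)]
    linear_combination q ^ (k + 2) * h₂ + q * h₁ - q * (q ^ (n + 1) - 1) * h₃

variable {A : Type*} [Ring A] [Algebra K A]

lemma mul_pow_of_qcomm {y z : A} (h : z * y = q • (y * z)) (k : ℕ) :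
    z * y ^ k = q ^ k • (y ^ k * z) := by
  induction k with
  | zero => simp
  | succ k ih =>
    rw [pow_succ, ← mul_assoc, ih, smul_mul_assoc, mul_assoc, h, mul_smul_comm, smul_smul,
      ← pow_succ, mul_assoc]

lemma mul_pow_eq_smul {y z : A} (h : z * y = q • (y * z)) (k : ℕ) :
    ∃ c : K, (y * z) ^ k = c • (y ^ k * z ^ k) := by
  induction k with
  | zero => exact ⟨1, by simp⟩
  | succ k ih =>
    obtain ⟨c, hc⟩ := ih
    refine ⟨q ^ k * c, ?_⟩
    rw [pow_succ', hc, mul_smul_comm, mul_assoc, ← mul_assoc z, mul_pow_of_qcomm q h,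
      smul_mul_assoc, mul_smul_comm, smul_smul, mul_comm c, mul_assoc (y ^ k), ← pow_succ',
      ← mul_assoc, ← pow_succ']

/-- If `b a = q a b` and `u` is the inverse of `a`, then `u b = q b u`. -/
lemma inv_qcomm {a b u : A} (h : b * a = q • (a * b)) (h₁ : a * u = 1) (h₂ : u * a = 1) :
    u * b = q • (b * u) := by
  calc u * b = u * (b * a) * u := by rw [mul_assoc, mul_assoc, h₁, mul_one]
    _ = q • (b * u) := by
      rw [h, mul_smul_comm, smul_mul_assoc, ← mul_assoc u, h₂, one_mul]

lemma add_pow_of_qcomm {y z : A} (h : z * y = q • (y * z)) (n : ℕ) :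
    (y + z) ^ n = ∑ k ∈ Finset.range (n + 1), coeff q n k • (y ^ k * z ^ (n - k)) := by
  induction n with
  | zero => simp [coeff]
  | succ n ih =>
    have h₁ : y * ∑ k ∈ Finset.range (n + 1), coeff q n k • (y ^ k * z ^ (n - k)) =
        ∑ k ∈ Finset.range (n + 1), coeff q n k • (y ^ (k + 1) * z ^ (n + 1 - (k + 1))) := by
      rw [Finset.mul_sum]
      refine Finset.sum_congr rfl fun k _ => ?_
      rw [mul_smul_comm, ← mul_assoc, ← pow_succ', Nat.add_sub_add_right]
    have h₂ : z * ∑ k ∈ Finset.range (n + 1), coeff q n k • (y ^ k * z ^ (n - k)) =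
        ∑ k ∈ Finset.range (n + 2), (q ^ k * coeff q n k) • (y ^ k * z ^ (n + 1 - k)) := by
      rw [Finset.sum_range_succ _ (n + 1), coeff_eq_zero q (Nat.lt_succ_self n), mul_zero,
        zero_smul, add_zero, Finset.mul_sum]
      refine Finset.sum_congr rfl fun k hk => ?_
      have hk' : n + 1 - k = (n - k) + 1 := by
        have := Finset.mem_range.1 hk
        omega
      rw [mul_smul_comm, ← mul_assoc, mul_pow_of_qcomm q h, smul_mul_assoc, smul_smul, mul_assoc,
        ← pow_succ', hk', mul_comm (q ^ k)]
    rw [pow_succ', ih, add_mul, h₁, h₂, Finset.sum_range_succ' _ (n + 1),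
      Finset.sum_range_succ' _ (n + 1), ← add_assoc, ← Finset.sum_add_distrib]
    simp only [coeff_succ_succ, add_smul, coeff_zero_right, pow_zero, mul_one]

lemma add_pow_of_isPrimitiveRoot {m : ℕ} (hm : 0 < m) (hq : IsPrimitiveRoot q m) {y z : A}
    (h : z * y = q • (y * z)) : (y + z) ^ m = y ^ m + z ^ m := by
  obtain ⟨m, rfl⟩ : ∃ l, m = l + 1 := ⟨m - 1, by omega⟩
  rw [add_pow_of_qcomm q h, Finset.sum_range_succ, Finset.sum_range_succ', Finset.sum_eq_zero]
  · simp [coeff_self, coeff_zero_right, add_comm]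
  · intro k hk
    have hk := Finset.mem_range.1 hk
    have h₁ := pow_sub_one_mul_coeff q m k
    rw [hq.pow_eq_one, sub_self, zero_mul] at h₁
    have h₂ : q ^ (k + 1) - 1 ≠ 0 :=
      sub_ne_zero.2 (hq.pow_ne_one_of_pos_of_lt (by omega) (by omega))
    rw [(mul_eq_zero.1 h₁).resolve_left h₂, zero_smul]

end QBinomial

/-! ### Antipodes given on algebra generators -/

section Antipode

variable {K A : Type*} [Field K] [Ring A] [Bialgebra K A]

/-- The linear endomorphism underlying an algebra map `A → Aᵐᵒᵖ`. -/
def antiLinear (S : A →ₐ[K] Aᵐᵒᵖ) : A →ₗ[K] A :=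
  (MulOpposite.opLinearEquiv K).symm.toLinearMap ∘ₗ S.toLinearMap

lemma antiLinear_apply (S : A →ₐ[K] Aᵐᵒᵖ) (a : A) : antiLinear S a = (S a).unop := rfl

lemma antiLinear_mul (S : A →ₐ[K] Aᵐᵒᵖ) (a b : A) :
    antiLinear S (a * b) = antiLinear S b * antiLinear S a := by
  simp [antiLinear_apply]

/-- A bialgebra with an algebra map `S : A → Aᵐᵒᵖ` that satisfies the antipode axioms on a set of
algebra generators is a Hopf algebra with antipode `S`. -/
@[reducible]
def hopfAlgebraOfAdjoin (S : A →ₐ[K] Aᵐᵒᵖ) (s : Set A) (hs : Algebra.adjoin K s = ⊤)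
    (hr : ∀ a ∈ s, LinearMap.mul' K A ((antiLinear S).rTensor A (Coalgebra.comul a)) =
      algebraMap K A (Coalgebra.counit a))
    (hl : ∀ a ∈ s, LinearMap.mul' K A ((antiLinear S).lTensor A (Coalgebra.comul a)) =
      algebraMap K A (Coalgebra.counit a)) : HopfAlgebra K A where
  antipode := antiLinear S
  mul_antipode_rTensor_comul := by
    ext a
    have ha : a ∈ Algebra.adjoin K s := hs ▸ Algebra.mem_top
    induction ha using Algebra.adjoin_induction with
    | mem a ha => exact hr a ha
    | algebraMap r => simp [Algebra.TensorProduct.algebraMap_apply, antiLinear_apply]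
    | add a b _ _ iha ihb =>
      simp only [map_add, iha, ihb]
    | mul a b _ _ iha ihb =>
      simp only [LinearMap.comp_apply, Algebra.linearMap_apply] at iha ihb ⊢
      have key : ∀ u v : A ⊗[K] A, ∀ c : K,
          LinearMap.mul' K A ((antiLinear S).rTensor A u) = algebraMap K A c →
          LinearMap.mul' K A ((antiLinear S).rTensor A (u * v)) =
            c • LinearMap.mul' K A ((antiLinear S).rTensor A v) := by
        intro u v c hu
        induction v using TensorProduct.induction_on with
        | zero => simp
        | add v w hv hw => simp only [mul_add, map_add, hv, hw, smul_add]
        | tmul p p' =>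
          have h : LinearMap.mul' K A ((antiLinear S).rTensor A (u * p ⊗ₜ[K] p')) =
              antiLinear S p * LinearMap.mul' K A ((antiLinear S).rTensor A u) * p' := by
            clear hu
            induction u using TensorProduct.induction_on with
            | zero => simp
            | add v w hv hw => simp only [mul_add, add_mul, map_add, hv, hw]
            | tmul r r' => simp [antiLinear_mul, mul_assoc]
          rw [h, hu, ← Algebra.commutes, mul_assoc, ← Algebra.smul_def]
          simp
      rw [Bialgebra.comul_mul, key _ _ _ iha, ihb, Bialgebra.counit_mul, map_mul,
        Algebra.smul_def]
  mul_antipode_lTensor_comul := by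
    ext a
    have ha : a ∈ Algebra.adjoin K s := hs ▸ Algebra.mem_top
    induction ha using Algebra.adjoin_induction with
    | mem a ha => exact hl a ha
    | algebraMap r => simp [Algebra.TensorProduct.algebraMap_apply, antiLinear_apply]
    | add a b _ _ iha ihb =>
      simp only [map_add, iha, ihb]
    | mul a b _ _ iha ihb =>
      simp only [LinearMap.comp_apply, Algebra.linearMap_apply] at iha ihb ⊢
      have key : ∀ u v : A ⊗[K] A, ∀ c : K,
          LinearMap.mul' K A ((antiLinear S).lTensor A v) = algebraMap K A c →
          LinearMap.mul' K A ((antiLinear S).lTensor A (u * v)) =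
            c • LinearMap.mul' K A ((antiLinear S).lTensor A u) := by
        intro u v c hv
        induction u using TensorProduct.induction_on with
        | zero => simp
        | add u w hu hw => simp only [add_mul, map_add, hu, hw, smul_add]
        | tmul p p' =>
          have h : LinearMap.mul' K A ((antiLinear S).lTensor A (p ⊗ₜ[K] p' * v)) =
              p * LinearMap.mul' K A ((antiLinear S).lTensor A v) * antiLinear S p' := by
            clear hv
            induction v using TensorProduct.induction_on with
            | zero => simp
            | add v w hv hw => simp only [mul_add, add_mul, map_add, hv, hw]
            | tmul r r' => simp [antiLinear_mul, mul_assoc]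
          rw [h, hv, ← Algebra.commutes, mul_assoc, ← Algebra.smul_def]
          simp
      rw [Bialgebra.comul_mul, key _ _ _ ihb, iha, Bialgebra.counit_mul, map_mul,
        Algebra.smul_def, Algebra.commutes]

end Antipode

/-! ### The Taft algebra -/

/-- Names of the generators of the Taft algebra. -/
inductive TaftGen
  | h
  | x

/-- The defining relations of the Taft algebra: `h ^ m = 1`, `x ^ m = 0`, `x h = q h x`. -/
inductive TaftRel {K : Type*} [Field K] (m : ℕ) (q : K) :
    FreeAlgebra K TaftGen → FreeAlgebra K TaftGen → Prop
  | h_pow : TaftRel m q (FreeAlgebra.ι K .h ^ m) 1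
  | x_pow : TaftRel m q (FreeAlgebra.ι K .x ^ m) 0
  | x_h : TaftRel m q (FreeAlgebra.ι K .x * FreeAlgebra.ι K .h)
      (q • (FreeAlgebra.ι K .h * FreeAlgebra.ι K .x))

/-- The Taft algebra `T_{m²}(q)`: the `K`-algebra generated by `h`, `x` subject to
`h ^ m = 1`, `x ^ m = 0`, `x h = q h x`. -/
def TaftAlgebra {K : Type*} [Field K] (m : ℕ) (q : K) : Type _ :=
  RingQuot (TaftRel m q)

namespace TaftAlgebra

variable {K : Type*} [Field K] (m : ℕ) (q : K)

instance : Ring (TaftAlgebra m q) := inferInstanceAs (Ring (RingQuot (TaftRel m q)))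

instance : Algebra K (TaftAlgebra m q) := inferInstanceAs (Algebra K (RingQuot (TaftRel m q)))

/-- The quotient map from the free algebra. -/
def mk : FreeAlgebra K TaftGen →ₐ[K] TaftAlgebra m q := RingQuot.mkAlgHom K (TaftRel m q)

/-- The generator `h`. -/
def h : TaftAlgebra m q := mk m q (FreeAlgebra.ι K .h)

/-- The generator `x`. -/
def x : TaftAlgebra m q := mk m q (FreeAlgebra.ι K .x)

lemma h_pow : h m q ^ m = 1 := by
  have := RingQuot.mkAlgHom_rel K (TaftRel.h_pow (m := m) (q := q))
  rwa [map_pow, map_one] at this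

lemma x_pow : x m q ^ m = 0 := by
  have := RingQuot.mkAlgHom_rel K (TaftRel.x_pow (m := m) (q := q))
  rwa [map_pow, map_zero] at this

lemma x_mul_h : x m q * h m q = q • (h m q * x m q) := by
  have := RingQuot.mkAlgHom_rel K (TaftRel.x_h (m := m) (q := q))
  rwa [map_mul, map_smul, map_mul] at this

variable {m q} in
/-- The universal property of the presentation. -/
def lift {B : Type*} [Ring B] [Algebra K B] (a b : B) (h₁ : a ^ m = 1) (h₂ : b ^ m = 0)
    (h₃ : b * a = q • (a * b)) : TaftAlgebra m q →ₐ[K] B :=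
  RingQuot.liftAlgHom K ⟨FreeAlgebra.lift K (fun | .h => a | .x => b), by
    rintro _ _ (_ | _ | _) <;> simp [h₁, h₂, h₃]⟩

section lift

variable {m q} {B : Type*} [Ring B] [Algebra K B] (a b : B) (h₁ : a ^ m = 1) (h₂ : b ^ m = 0)
    (h₃ : b * a = q • (a * b))

@[simp]
lemma lift_h : lift a b h₁ h₂ h₃ (h m q) = a :=
  (RingQuot.liftAlgHom_mkAlgHom_apply K _ _ _).trans (FreeAlgebra.lift_ι_apply _ _)

@[simp]
lemma lift_x : lift a b h₁ h₂ h₃ (x m q) = b :=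
  (RingQuot.liftAlgHom_mkAlgHom_apply K _ _ _).trans (FreeAlgebra.lift_ι_apply _ _)

end lift

lemma adjoin_eq_top : Algebra.adjoin K {h m q, x m q} = ⊤ := by
  have hs : Function.Surjective (mk m q) := RingQuot.mkAlgHom_surjective K (TaftRel m q)
  have hr : {h m q, x m q} = mk m q '' Set.range (FreeAlgebra.ι K) := by
    ext a
    constructor
    · rintro (rfl | rfl)
      exacts [⟨_, ⟨.h, rfl⟩, rfl⟩, ⟨_, ⟨.x, rfl⟩, rfl⟩]
    · rintro ⟨_, ⟨_ | _, rfl⟩, rfl⟩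
      exacts [Or.inl rfl, Or.inr rfl]
  rw [hr, ← AlgHom.map_adjoin, FreeAlgebra.adjoin_range_ι, Algebra.map_top,
    AlgHom.range_eq_top]
  exact hs

variable {m q} in
lemma algHom_ext {B : Type*} [Semiring B] [Algebra K B] {f f' : TaftAlgebra m q →ₐ[K] B}
    (hh : f (h m q) = f' (h m q)) (hx : f (x m q) = f' (x m q)) : f = f' :=
  AlgHom.ext_of_adjoin_eq_top (adjoin_eq_top m q) (by rintro _ (rfl | rfl) <;> assumption)

lemma h_mul_h_pow [NeZero m] : h m q * h m q ^ (m - 1) = 1 := by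
  rw [mul_pow_sub_one (NeZero.ne m), h_pow]

lemma h_pow_mul_h [NeZero m] : h m q ^ (m - 1) * h m q = 1 := by
  rw [pow_sub_one_mul (NeZero.ne m), h_pow]

variable [NeZero m] [hq : Fact (IsPrimitiveRoot q m)]

/-- `Δ(h) = h ⊗ h`, `Δ(x) = x ⊗ h + 1 ⊗ x`. -/
def comulHom : TaftAlgebra m q →ₐ[K] TaftAlgebra m q ⊗[K] TaftAlgebra m q :=
  lift (h m q ⊗ₜ h m q) (x m q ⊗ₜ h m q + 1 ⊗ₜ x m q)
    (by simp [Algebra.TensorProduct.tmul_pow, h_pow, Algebra.TensorProduct.one_def])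
    (by
      rw [QBinomial.add_pow_of_isPrimitiveRoot q (NeZero.pos m) hq.out]
      · simp [Algebra.TensorProduct.tmul_pow, x_pow]
      · simp [x_mul_h])
    (by simp [add_mul, mul_add, x_mul_h, TensorProduct.smul_tmul'])

/-- `ε(h) = 1`, `ε(x) = 0`. -/
def counitHom : TaftAlgebra m q →ₐ[K] K :=
  lift 1 0 (one_pow m) (zero_pow (NeZero.ne m)) (by simp)

instance : Bialgebra K (TaftAlgebra m q) :=
  .ofAlgHom (comulHom m q) (counitHom m q)
    (by
      apply algHom_ext <;>
        simp [comulHom, TensorProduct.add_tmul, TensorProduct.tmul_add, add_assoc,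
          Algebra.TensorProduct.one_def])
    (by apply algHom_ext <;> simp [comulHom, counitHom])
    (by apply algHom_ext <;> simp [comulHom, counitHom])

@[simp]
lemma comul_h : Coalgebra.comul (R := K) (h m q) = h m q ⊗ₜ h m q := lift_h _ _ _ _ _

@[simp]
lemma comul_x : Coalgebra.comul (R := K) (x m q) = x m q ⊗ₜ h m q + 1 ⊗ₜ x m q :=
  lift_x _ _ _ _ _

@[simp]
lemma counit_h : Coalgebra.counit (R := K) (h m q) = 1 := lift_h _ _ _ _ _

@[simp]
lemma counit_x : Coalgebra.counit (R := K) (x m q) = 0 := lift_x _ _ _ _ _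

/-- `S(h) = h ^ (m - 1)`, `S(x) = - x h ^ (m - 1)`, as an algebra map to the opposite algebra. -/
def antipodeHom : TaftAlgebra m q →ₐ[K] (TaftAlgebra m q)ᵐᵒᵖ :=
  lift (.op (h m q ^ (m - 1))) (.op (-(x m q * h m q ^ (m - 1))))
    (by rw [← MulOpposite.op_pow, ← pow_mul, mul_comm, pow_mul, h_pow, one_pow,
      MulOpposite.op_one])
    (by
      have hc := QBinomial.inv_qcomm q (x_mul_h m q) (h_mul_h_pow m q) (h_pow_mul_h m q)
      obtain ⟨c, h⟩ := QBinomial.mul_pow_eq_smul q hc m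
      rw [← MulOpposite.op_pow, neg_pow, h, x_pow, zero_mul, smul_zero, mul_zero,
        MulOpposite.op_zero])
    (by
      have hc := QBinomial.inv_qcomm q (x_mul_h m q) (h_mul_h_pow m q) (h_pow_mul_h m q)
      rw [← MulOpposite.op_mul, ← MulOpposite.op_mul, ← MulOpposite.op_smul, mul_neg,
        ← mul_assoc, hc, smul_mul_assoc, neg_mul, smul_neg])

instance : HopfAlgebra K (TaftAlgebra m q) :=
  hopfAlgebraOfAdjoin (antipodeHom m q) {h m q, x m q} (adjoin_eq_top m q)
    (by
      rintro _ (rfl | rfl) <;>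
        simp [antiLinear_apply, antipodeHom, h_pow_mul_h, mul_assoc])
    (by
      rintro _ (rfl | rfl) <;>
        simp [antiLinear_apply, antipodeHom, h_mul_h_pow])

lemma antipode_h : HopfAlgebra.antipode K (h m q) = h m q ^ (m - 1) :=
  congrArg MulOpposite.unop (lift_h _ _ _ _ _)

lemma antipode_x : HopfAlgebra.antipode K (x m q) = -(x m q * h m q ^ (m - 1)) :=
  congrArg MulOpposite.unop (lift_x _ _ _ _ _)

end TaftAlgebra

/-! ### The Hopf algebras `T^ω_{nm²}(q)` -/

/-- Names of the generators of `T^ω_{nm²}(q)`. -/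
inductive ExtTaftGen
  | g
  | h
  | x

/-- The defining relations of `T^ω_{nm²}(q)`: `g ^ n = 1`, `h ^ m = 1`, `x ^ m = 0`,
`x h = q h x`, `h g = g h`, `g x = ω x g`. -/
inductive ExtTaftRel {K : Type*} [Field K] (n m : ℕ) (q ω : K) :
    FreeAlgebra K ExtTaftGen → FreeAlgebra K ExtTaftGen → Prop
  | g_pow : ExtTaftRel n m q ω (FreeAlgebra.ι K .g ^ n) 1
  | h_pow : ExtTaftRel n m q ω (FreeAlgebra.ι K .h ^ m) 1
  | x_pow : ExtTaftRel n m q ω (FreeAlgebra.ι K .x ^ m) 0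
  | x_h : ExtTaftRel n m q ω (FreeAlgebra.ι K .x * FreeAlgebra.ι K .h)
      (q • (FreeAlgebra.ι K .h * FreeAlgebra.ι K .x))
  | h_g : ExtTaftRel n m q ω (FreeAlgebra.ι K .h * FreeAlgebra.ι K .g)
      (FreeAlgebra.ι K .g * FreeAlgebra.ι K .h)
  | g_x : ExtTaftRel n m q ω (FreeAlgebra.ι K .g * FreeAlgebra.ι K .x)
      (ω • (FreeAlgebra.ι K .x * FreeAlgebra.ι K .g))

/-- The algebra `T^ω_{nm²}(q)` generated by `g`, `h`, `x` subject to `g ^ n = 1`, `h ^ m = 1`,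
`x ^ m = 0`, `x h = q h x`, `h g = g h`, `g x = ω x g`. -/
def ExtTaftAlgebra {K : Type*} [Field K] (n m : ℕ) (q ω : K) : Type _ :=
  RingQuot (ExtTaftRel n m q ω)

namespace ExtTaftAlgebra

variable {K : Type*} [Field K] (n m : ℕ) (q ω : K)

instance : Ring (ExtTaftAlgebra n m q ω) := inferInstanceAs (Ring (RingQuot (ExtTaftRel n m q ω)))

instance : Algebra K (ExtTaftAlgebra n m q ω) :=
  inferInstanceAs (Algebra K (RingQuot (ExtTaftRel n m q ω)))

/-- The quotient map from the free algebra. -/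
def mk : FreeAlgebra K ExtTaftGen →ₐ[K] ExtTaftAlgebra n m q ω :=
  RingQuot.mkAlgHom K (ExtTaftRel n m q ω)

/-- The generator `g`. -/
def g : ExtTaftAlgebra n m q ω := mk n m q ω (FreeAlgebra.ι K .g)

/-- The generator `h`. -/
def h : ExtTaftAlgebra n m q ω := mk n m q ω (FreeAlgebra.ι K .h)

/-- The generator `x`. -/
def x : ExtTaftAlgebra n m q ω := mk n m q ω (FreeAlgebra.ι K .x)

lemma g_pow : g n m q ω ^ n = 1 := by
  have := RingQuot.mkAlgHom_rel K (ExtTaftRel.g_pow (n := n) (m := m) (q := q) (ω := ω))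
  rwa [map_pow, map_one] at this

lemma h_pow : h n m q ω ^ m = 1 := by
  have := RingQuot.mkAlgHom_rel K (ExtTaftRel.h_pow (n := n) (m := m) (q := q) (ω := ω))
  rwa [map_pow, map_one] at this

lemma x_pow : x n m q ω ^ m = 0 := by
  have := RingQuot.mkAlgHom_rel K (ExtTaftRel.x_pow (n := n) (m := m) (q := q) (ω := ω))
  rwa [map_pow, map_zero] at this

lemma x_mul_h : x n m q ω * h n m q ω = q • (h n m q ω * x n m q ω) := by
  have := RingQuot.mkAlgHom_rel K (ExtTaftRel.x_h (n := n) (m := m) (q := q) (ω := ω))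
  rwa [map_mul, map_smul, map_mul] at this

lemma h_mul_g : h n m q ω * g n m q ω = g n m q ω * h n m q ω := by
  have := RingQuot.mkAlgHom_rel K (ExtTaftRel.h_g (n := n) (m := m) (q := q) (ω := ω))
  rwa [map_mul, map_mul] at this

lemma g_mul_x : g n m q ω * x n m q ω = ω • (x n m q ω * g n m q ω) := by
  have := RingQuot.mkAlgHom_rel K (ExtTaftRel.g_x (n := n) (m := m) (q := q) (ω := ω))
  rwa [map_mul, map_smul, map_mul] at this

variable {n m q ω} in
/-- The universal property of the presentation. -/
def lift {B : Type*} [Ring B] [Algebra K B] (c a b : B) (h₀ : c ^ n = 1) (h₁ : a ^ m = 1)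
    (h₂ : b ^ m = 0) (h₃ : b * a = q • (a * b)) (h₄ : a * c = c * a)
    (h₅ : c * b = ω • (b * c)) : ExtTaftAlgebra n m q ω →ₐ[K] B :=
  RingQuot.liftAlgHom K ⟨FreeAlgebra.lift K (fun | .g => c | .h => a | .x => b), by
    rintro _ _ (_ | _ | _ | _ | _ | _) <;> simp [h₀, h₁, h₂, h₃, h₄, h₅]⟩

section lift

variable {n m q ω} {B : Type*} [Ring B] [Algebra K B] (c a b : B) (h₀ : c ^ n = 1)
    (h₁ : a ^ m = 1) (h₂ : b ^ m = 0) (h₃ : b * a = q • (a * b)) (h₄ : a * c = c * a)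
    (h₅ : c * b = ω • (b * c))

@[simp]
lemma lift_g : lift c a b h₀ h₁ h₂ h₃ h₄ h₅ (g n m q ω) = c :=
  (RingQuot.liftAlgHom_mkAlgHom_apply K _ _ _).trans (FreeAlgebra.lift_ι_apply _ _)

@[simp]
lemma lift_h : lift c a b h₀ h₁ h₂ h₃ h₄ h₅ (h n m q ω) = a :=
  (RingQuot.liftAlgHom_mkAlgHom_apply K _ _ _).trans (FreeAlgebra.lift_ι_apply _ _)

@[simp]
lemma lift_x : lift c a b h₀ h₁ h₂ h₃ h₄ h₅ (x n m q ω) = b :=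
  (RingQuot.liftAlgHom_mkAlgHom_apply K _ _ _).trans (FreeAlgebra.lift_ι_apply _ _)

end lift

lemma adjoin_eq_top : Algebra.adjoin K {g n m q ω, h n m q ω, x n m q ω} = ⊤ := by
  have hs : Function.Surjective (mk n m q ω) :=
    RingQuot.mkAlgHom_surjective K (ExtTaftRel n m q ω)
  have hr : {g n m q ω, h n m q ω, x n m q ω} =
      mk n m q ω '' Set.range (FreeAlgebra.ι K) := by
    ext a
    constructor
    · rintro (rfl | rfl | rfl)
      exacts [⟨_, ⟨.g, rfl⟩, rfl⟩, ⟨_, ⟨.h, rfl⟩, rfl⟩, ⟨_, ⟨.x, rfl⟩, rfl⟩]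
    · rintro ⟨_, ⟨_ | _ | _, rfl⟩, rfl⟩
      exacts [Or.inl rfl, Or.inr (Or.inl rfl), Or.inr (Or.inr rfl)]
  rw [hr, ← AlgHom.map_adjoin, FreeAlgebra.adjoin_range_ι, Algebra.map_top,
    AlgHom.range_eq_top]
  exact hs

variable {n m q ω} in
lemma algHom_ext {B : Type*} [Semiring B] [Algebra K B] {f f' : ExtTaftAlgebra n m q ω →ₐ[K] B}
    (hg : f (g n m q ω) = f' (g n m q ω)) (hh : f (h n m q ω) = f' (h n m q ω))
    (hx : f (x n m q ω) = f' (x n m q ω)) : f = f' :=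
  AlgHom.ext_of_adjoin_eq_top (adjoin_eq_top n m q ω)
    (by rintro _ (rfl | rfl | rfl) <;> assumption)

lemma h_mul_h_pow [NeZero m] : h n m q ω * h n m q ω ^ (m - 1) = 1 := by
  rw [mul_pow_sub_one (NeZero.ne m), h_pow]

lemma h_pow_mul_h [NeZero m] : h n m q ω ^ (m - 1) * h n m q ω = 1 := by
  rw [pow_sub_one_mul (NeZero.ne m), h_pow]

lemma g_mul_g_pow [NeZero n] : g n m q ω * g n m q ω ^ (n - 1) = 1 := by
  rw [mul_pow_sub_one (NeZero.ne n), g_pow]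

lemma g_pow_mul_g [NeZero n] : g n m q ω ^ (n - 1) * g n m q ω = 1 := by
  rw [pow_sub_one_mul (NeZero.ne n), g_pow]

lemma x_mul_g_pow [NeZero n] :
    x n m q ω * g n m q ω ^ (n - 1) = ω • (g n m q ω ^ (n - 1) * x n m q ω) := by
  calc x n m q ω * g n m q ω ^ (n - 1)
      = g n m q ω ^ (n - 1) * (g n m q ω * x n m q ω) * g n m q ω ^ (n - 1) := by
        rw [← mul_assoc, g_pow_mul_g, one_mul]
    _ = ω • (g n m q ω ^ (n - 1) * x n m q ω) := by
        rw [g_mul_x, mul_smul_comm, smul_mul_assoc, mul_assoc, mul_assoc, g_mul_g_pow, mul_one]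

lemma tmul_h_mul_g : (h n m q ω ⊗ₜ[K] h n m q ω) * (g n m q ω ⊗ₜ[K] g n m q ω) =
    (g n m q ω ⊗ₜ[K] g n m q ω) * (h n m q ω ⊗ₜ[K] h n m q ω) := by
  rw [Algebra.TensorProduct.tmul_mul_tmul, Algebra.TensorProduct.tmul_mul_tmul, h_mul_g]

variable [NeZero m] [hq : Fact (IsPrimitiveRoot q m)]

/-- `Δ(g) = g ⊗ g`, `Δ(h) = h ⊗ h`, `Δ(x) = x ⊗ h + 1 ⊗ x`. -/
def comulHom :
    ExtTaftAlgebra n m q ω →ₐ[K] ExtTaftAlgebra n m q ω ⊗[K] ExtTaftAlgebra n m q ω :=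
  lift (g n m q ω ⊗ₜ g n m q ω) (h n m q ω ⊗ₜ h n m q ω)
    (x n m q ω ⊗ₜ h n m q ω + 1 ⊗ₜ x n m q ω)
    (by simp [Algebra.TensorProduct.tmul_pow, g_pow, Algebra.TensorProduct.one_def])
    (by simp [Algebra.TensorProduct.tmul_pow, h_pow, Algebra.TensorProduct.one_def])
    (by
      rw [QBinomial.add_pow_of_isPrimitiveRoot q (NeZero.pos m) hq.out]
      · simp [Algebra.TensorProduct.tmul_pow, x_pow]
      · simp [x_mul_h])
    (by simp [add_mul, mul_add, x_mul_h, TensorProduct.smul_tmul'])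
    (tmul_h_mul_g n m q ω)
    (by simp [add_mul, mul_add, g_mul_x, h_mul_g, TensorProduct.smul_tmul'])

/-- `ε(g) = 1`, `ε(h) = 1`, `ε(x) = 0`. -/
def counitHom : ExtTaftAlgebra n m q ω →ₐ[K] K :=
  lift 1 1 0 (one_pow n) (one_pow m) (zero_pow (NeZero.ne m)) (by simp) rfl (by simp)

instance : Bialgebra K (ExtTaftAlgebra n m q ω) :=
  .ofAlgHom (comulHom n m q ω) (counitHom n m q ω)
    (by
      apply algHom_ext <;>
        simp [comulHom, TensorProduct.add_tmul, TensorProduct.tmul_add, add_assoc,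
          Algebra.TensorProduct.one_def])
    (by apply algHom_ext <;> simp [comulHom, counitHom])
    (by apply algHom_ext <;> simp [comulHom, counitHom])

@[simp]
lemma comul_g : Coalgebra.comul (R := K) (g n m q ω) = g n m q ω ⊗ₜ g n m q ω :=
  lift_g _ _ _ _ _ _ _ _ _

@[simp]
lemma comul_h : Coalgebra.comul (R := K) (h n m q ω) = h n m q ω ⊗ₜ h n m q ω :=
  lift_h _ _ _ _ _ _ _ _ _

@[simp]
lemma comul_x :
    Coalgebra.comul (R := K) (x n m q ω) = x n m q ω ⊗ₜ h n m q ω + 1 ⊗ₜ x n m q ω :=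
  lift_x _ _ _ _ _ _ _ _ _

@[simp]
lemma counit_g : Coalgebra.counit (R := K) (g n m q ω) = 1 := lift_g _ _ _ _ _ _ _ _ _

@[simp]
lemma counit_h : Coalgebra.counit (R := K) (h n m q ω) = 1 := lift_h _ _ _ _ _ _ _ _ _

@[simp]
lemma counit_x : Coalgebra.counit (R := K) (x n m q ω) = 0 := lift_x _ _ _ _ _ _ _ _ _

variable [NeZero n]

/-- `S(g) = g ^ (n - 1)`, `S(h) = h ^ (m - 1)`, `S(x) = - x h ^ (m - 1)`, as an algebra map to the
opposite algebra. -/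
def antipodeHom : ExtTaftAlgebra n m q ω →ₐ[K] (ExtTaftAlgebra n m q ω)ᵐᵒᵖ :=
  lift (.op (g n m q ω ^ (n - 1))) (.op (h n m q ω ^ (m - 1)))
    (.op (-(x n m q ω * h n m q ω ^ (m - 1))))
    (by rw [← MulOpposite.op_pow, ← pow_mul, mul_comm, pow_mul, g_pow, one_pow,
      MulOpposite.op_one])
    (by rw [← MulOpposite.op_pow, ← pow_mul, mul_comm, pow_mul, h_pow, one_pow,
      MulOpposite.op_one])
    (by
      have hc := QBinomial.inv_qcomm q (x_mul_h n m q ω) (h_mul_h_pow n m q ω)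
        (h_pow_mul_h n m q ω)
      obtain ⟨c, h⟩ := QBinomial.mul_pow_eq_smul q hc m
      rw [← MulOpposite.op_pow, neg_pow, h, x_pow, zero_mul, smul_zero, mul_zero,
        MulOpposite.op_zero])
    (by
      have hc := QBinomial.inv_qcomm q (x_mul_h n m q ω) (h_mul_h_pow n m q ω)
        (h_pow_mul_h n m q ω)
      rw [← MulOpposite.op_mul, ← MulOpposite.op_mul, ← MulOpposite.op_smul, mul_neg,
        ← mul_assoc, hc, smul_mul_assoc, neg_mul, smul_neg])
    (by
      have hc : Commute (h n m q ω) (g n m q ω) := h_mul_g n m q ω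
      rw [← MulOpposite.op_mul, ← MulOpposite.op_mul, (hc.pow_pow (m - 1) (n - 1)).eq])
    (by
      have hc : Commute (h n m q ω) (g n m q ω) := h_mul_g n m q ω
      rw [← MulOpposite.op_mul, ← MulOpposite.op_mul, ← MulOpposite.op_smul, neg_mul, mul_assoc,
        (hc.pow_pow (m - 1) (n - 1)).eq, ← mul_assoc, x_mul_g_pow, mul_neg, smul_neg,
        smul_mul_assoc, mul_assoc])

instance : HopfAlgebra K (ExtTaftAlgebra n m q ω) :=
  hopfAlgebraOfAdjoin (antipodeHom n m q ω) {g n m q ω, h n m q ω, x n m q ω}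
    (adjoin_eq_top n m q ω)
    (by
      rintro _ (rfl | rfl | rfl) <;>
        simp [antiLinear_apply, antipodeHom, h_pow_mul_h, g_pow_mul_g, mul_assoc])
    (by
      rintro _ (rfl | rfl | rfl) <;>
        simp [antiLinear_apply, antipodeHom, h_mul_h_pow, g_mul_g_pow])

lemma antipode_g : HopfAlgebra.antipode K (g n m q ω) = g n m q ω ^ (n - 1) :=
  congrArg MulOpposite.unop (lift_g _ _ _ _ _ _ _ _ _)

lemma antipode_h : HopfAlgebra.antipode K (h n m q ω) = h n m q ω ^ (m - 1) :=
  congrArg MulOpposite.unop (lift_h _ _ _ _ _ _ _ _ _)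

lemma antipode_x :
    HopfAlgebra.antipode K (x n m q ω) = -(x n m q ω * h n m q ω ^ (m - 1)) :=
  congrArg MulOpposite.unop (lift_x _ _ _ _ _ _ _ _ _)

end ExtTaftAlgebra

end

/-!
Let `E` factorize through `T = T_{m²}(q)` and `K[Cₙ]`, identify both with their images, and let
`γ` be a group-like element of `Cₙ`. The functional `f : ay ↦ ε(a) γ^*(y)` on `E`, where `γ^*(y)`
is the coefficient of `γ` in `y`, satisfies `∑ f(e₁) e₂ = ∑ f(e₂) e₁` because `K[Cₙ]` is
cocommutative, and the image of `e ↦ ∑ f(e₁) e₂` is `Tγ`. On the skew primitive element `γx` the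
symmetry forces either `x ∈ K(1 - h)`, which fails for `m ≥ 2`, or `γh, γx ∈ Tγ`. So `γTγ⁻¹ ⊆ T`,
and conjugation by `γ` is an automorphism of the Hopf algebra `T`.

Such an automorphism maps `x` to a `(t, 1)`-skew primitive `s` and `h` to the group-like `t`. For
the functional `x^*` dual to `x`, the identity `[a, h] = (q - 1) ∑ x^*(a₁) a₂ x` in `T` shows that
`t` and `h` commute and that `[s, h]` is a multiple of `tx`. The multiple is nonzero, as `h` is
not central, and then slicing with `x^*` on the other side gives `t = h`, whence `s = ωx`. So the
relations of `T^ω_{nm²}(q)` hold in `E`, with `ωⁿ = 1`. The induced map `T^ω_{nm²}(q) → E` is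
bijective since `T^ω_{nm²}(q)` itself factorizes through `T` and `K[Cₙ]`: its multiplication map
from `T ⊗ K[Cₙ]` is injective because `T^ω_{nm²}(q)` acts on the smash product of `T` and `K[Cₙ]`.
-/

noncomputable section

section Slice

open Coalgebra

variable {K C D : Type*} [CommSemiring K] [AddCommMonoid C] [Module K C] [Coalgebra K C]
  [AddCommMonoid D] [Module K D] [Coalgebra K D]

/-- The action `c ↦ ∑ f(c₁) c₂` of a functional `f` on a coalgebra. -/
def sliceLeft (f : C →ₗ[K] K) : C →ₗ[K] C :=
  (TensorProduct.lid K C).toLinearMap ∘ₗ f.rTensor C ∘ₗ comul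

/-- The action `c ↦ ∑ f(c₂) c₁` of a functional `f` on a coalgebra. -/
def sliceRight (f : C →ₗ[K] K) : C →ₗ[K] C :=
  (TensorProduct.rid K C).toLinearMap ∘ₗ f.lTensor C ∘ₗ comul

lemma sliceLeft_apply (f : C →ₗ[K] K) (c : C) :
    sliceLeft f c = TensorProduct.lid K C (f.rTensor C (comul c)) := rfl

lemma sliceRight_apply (f : C →ₗ[K] K) (c : C) :
    sliceRight f c = TensorProduct.rid K C (f.lTensor C (comul c)) := rfl

lemma sliceLeft_counit : sliceLeft (counit : C →ₗ[K] K) = .id := by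
  ext c
  simp [sliceLeft_apply]

lemma sliceRight_counit : sliceRight (counit : C →ₗ[K] K) = .id := by
  ext c
  simp [sliceRight_apply]

lemma sliceLeft_coalgHom_apply (f : D →ₗ[K] K) (φ : C →ₗc[K] D) (c : C) :
    sliceLeft f (φ c) = φ (sliceLeft (f ∘ₗ φ) c) := by
  rw [sliceLeft_apply, sliceLeft_apply, ← CoalgHomClass.map_comp_comul_apply]
  induction comul (R := K) c with
  | zero => simp
  | tmul a b => simp
  | add z w hz hw => simp only [map_add, hz, hw]

lemma sliceLeft_eq_sliceRight_of_isCocomm [IsCocomm K C] (f : C →ₗ[K] K) :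
    sliceLeft f = sliceRight f := by
  ext c
  rw [sliceLeft_apply, sliceRight_apply]
  conv_lhs => rw [← comm_comul K c]
  induction comul (R := K) c with
  | zero => simp
  | tmul a b => simp
  | add z w hz hw => simp only [map_add, hz, hw]

lemma sliceRight_coalgHom_apply (f : D →ₗ[K] K) (φ : C →ₗc[K] D) (c : C) :
    sliceRight f (φ c) = φ (sliceRight (f ∘ₗ φ) c) := by
  rw [sliceRight_apply, sliceRight_apply, ← CoalgHomClass.map_comp_comul_apply]
  induction comul (R := K) c with
  | zero => simp
  | tmul a b => simp
  | add z w hz hw => simp only [map_add, hz, hw]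

lemma sliceLeft_mul'_map (f : C →ₗ[K] K) (f' : D →ₗ[K] K) :
    sliceLeft (LinearMap.mul' K K ∘ₗ TensorProduct.map f f') =
      TensorProduct.map (sliceLeft f) (sliceLeft f') := by
  ext c d
  simp only [TensorProduct.AlgebraTensorModule.curry_apply, LinearMap.restrictScalars_self,
    TensorProduct.curry_apply, TensorProduct.map_tmul, sliceLeft_apply, TensorProduct.comul_tmul]
  induction comul (R := K) c with
  | zero => simp
  | add z w hz hw => simp only [TensorProduct.add_tmul, map_add, hz, hw]
  | tmul a b =>
    induction comul (R := K) d with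
    | zero => simp
    | add z w hz hw => simp only [TensorProduct.tmul_add, map_add, hz, hw]
    | tmul a' b' => simp [TensorProduct.smul_tmul', mul_smul, smul_comm (f a)]

lemma sliceRight_mul'_map (f : C →ₗ[K] K) (f' : D →ₗ[K] K) :
    sliceRight (LinearMap.mul' K K ∘ₗ TensorProduct.map f f') =
      TensorProduct.map (sliceRight f) (sliceRight f') := by
  ext c d
  simp only [TensorProduct.AlgebraTensorModule.curry_apply, LinearMap.restrictScalars_self,
    TensorProduct.curry_apply, TensorProduct.map_tmul, sliceRight_apply, TensorProduct.comul_tmul]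
  induction comul (R := K) c with
  | zero => simp
  | add z w hz hw => simp only [TensorProduct.add_tmul, map_add, hz, hw]
  | tmul a b =>
    induction comul (R := K) d with
    | zero => simp
    | add z w hz hw => simp only [TensorProduct.tmul_add, map_add, hz, hw]
    | tmul a' b' => simp [TensorProduct.smul_tmul', mul_smul, smul_comm (f b)]

end Slice

section SkewPrimitive

open Coalgebra

/-- An element `c` is `(u, v)`-skew primitive if `Δ c = c ⊗ u + v ⊗ c`, as the generator `x` of a
Taft algebra is for `u = h` and `v = 1`. -/
structure IsSkewPrimitive (K : Type*) {C : Type*} [CommSemiring K] [AddCommMonoid C] [Module K C]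
    [Coalgebra K C] (u v c : C) : Prop where
  comul_eq : comul (R := K) c = c ⊗ₜ u + v ⊗ₜ c

section Coalgebra

variable {K C D : Type*} [CommSemiring K] [AddCommMonoid C] [Module K C] [Coalgebra K C]
  [AddCommMonoid D] [Module K D] [Coalgebra K D] {u v c : C}

lemma sliceLeft_groupLike (f : C →ₗ[K] K) (hu : IsGroupLikeElem K u) :
    sliceLeft f u = f u • u := by
  simp [sliceLeft_apply, hu.comul_eq_tmul_self]

lemma sliceRight_groupLike (f : C →ₗ[K] K) (hu : IsGroupLikeElem K u) :
    sliceRight f u = f u • u := by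
  simp [sliceRight_apply, hu.comul_eq_tmul_self]

namespace IsSkewPrimitive

lemma sliceLeft_eq (f : C →ₗ[K] K) (hc : IsSkewPrimitive K u v c) :
    sliceLeft f c = f c • u + f v • c := by
  simp [sliceLeft_apply, hc.comul_eq]

lemma sliceRight_eq (f : C →ₗ[K] K) (hc : IsSkewPrimitive K u v c) :
    sliceRight f c = f u • c + f c • v := by
  simp [sliceRight_apply, hc.comul_eq]

lemma map (φ : C →ₗc[K] D) (hc : IsSkewPrimitive K u v c) :
    IsSkewPrimitive K (φ u) (φ v) (φ c) := by
  constructor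
  rw [← CoalgHomClass.map_comp_comul_apply, hc.comul_eq]
  simp

end IsSkewPrimitive

end Coalgebra

namespace IsSkewPrimitive

lemma eq_smul_sub_or_mem_range {K C : Type*} [Field K] [AddCommGroup C] [Module K C]
    [Coalgebra K C] {f : C →ₗ[K] K} (hf : sliceLeft f = sliceRight f) {u v c : C}
    (hc : IsSkewPrimitive K u v c) (hu : IsGroupLikeElem K u) (hv : f v = 1) :
    c = f c • (v - u) ∨ u ∈ LinearMap.range (sliceLeft f) ∧ c ∈ LinearMap.range (sliceLeft f) := by
  by_cases hfu : f u = 0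
  · left
    have h : f c • u + f v • c = f u • c + f c • v := by
      rw [← hc.sliceLeft_eq, hf, hc.sliceRight_eq]
    rw [hv, hfu, one_smul, zero_smul, zero_add] at h
    rw [smul_sub, ← h, add_sub_cancel_left]
  · right
    have hu_mem : u ∈ LinearMap.range (sliceLeft f) := by
      refine ⟨(f u)⁻¹ • u, ?_⟩
      rw [map_smul, sliceLeft_groupLike f hu, inv_smul_smul₀ hfu]
    refine ⟨hu_mem, ?_⟩
    have hc_eq : c = sliceLeft f c - f c • u := by
      rw [hc.sliceLeft_eq, hv, one_smul, add_sub_cancel_left]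
    rw [hc_eq]
    exact sub_mem (LinearMap.mem_range_self _ c) (Submodule.smul_mem _ _ hu_mem)

variable {K A : Type*} [CommSemiring K] [Semiring A] [Bialgebra K A] {u v c g : A}

lemma groupLike_mul (hg : IsGroupLikeElem K g) (hc : IsSkewPrimitive K u v c) :
    IsSkewPrimitive K (g * u) (g * v) (g * c) := by
  constructor
  rw [Bialgebra.comul_mul, hg.comul_eq_tmul_self, hc.comul_eq, mul_add,
    Algebra.TensorProduct.tmul_mul_tmul, Algebra.TensorProduct.tmul_mul_tmul]

lemma mul_groupLike (hg : IsGroupLikeElem K g) (hc : IsSkewPrimitive K u v c) :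
    IsSkewPrimitive K (u * g) (v * g) (c * g) := by
  constructor
  rw [Bialgebra.comul_mul, hg.comul_eq_tmul_self, hc.comul_eq, add_mul,
    Algebra.TensorProduct.tmul_mul_tmul, Algebra.TensorProduct.tmul_mul_tmul]

end IsSkewPrimitive

end SkewPrimitive

section BialgebraSlice

variable {K A : Type*} [CommSemiring K] [Semiring A] [Bialgebra K A]

lemma sliceLeft_algHom_mul (χ : A →ₐ[K] K) (a b : A) :
    sliceLeft χ.toLinearMap (a * b) = sliceLeft χ.toLinearMap a * sliceLeft χ.toLinearMap b :=
  map_mul ((Algebra.TensorProduct.lid K A).toAlgHom.comp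
    ((Algebra.TensorProduct.map χ (.id K A)).comp (Bialgebra.comulAlgHom K A))) a b

lemma sliceLeft_mul_of_skewDerivation {f : A →ₗ[K] K} {ε χ : A →ₐ[K] K}
    (hf : ∀ a b, f (a * b) = ε a * f b + f a * χ b) (a b : A) :
    sliceLeft f (a * b) = sliceLeft ε.toLinearMap a * sliceLeft f b +
      sliceLeft f a * sliceLeft χ.toLinearMap b := by
  simp only [sliceLeft_apply, Bialgebra.comul_mul]
  induction Coalgebra.comul (R := K) a with
  | zero => simp
  | add z w hz hw => simp only [add_mul, map_add, hz, hw]; abel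
  | tmul a₁ a₂ =>
    induction Coalgebra.comul (R := K) b with
    | zero => simp
    | add z w hz hw => simp only [mul_add, map_add, hz, hw]; abel
    | tmul b₁ b₂ => simp [hf, add_smul, smul_smul, mul_comm]

end BialgebraSlice

namespace TaftAlgebra

open Coalgebra

section Coefficients

variable {K : Type*} [Field K] {m : ℕ} (q : K) [hq : Fact (IsPrimitiveRoot q m)]

/-- The two-dimensional representation `h ↦ diag(1, q)`, `x ↦ E₁₂`. -/
def matrixRep (hm : 2 ≤ m) : TaftAlgebra m q →ₐ[K] Matrix (Fin 2) (Fin 2) K :=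
  lift (Matrix.diagonal ![1, q]) !![0, 1; 0, 0]
    (by
      rw [Matrix.diagonal_pow, ← Matrix.diagonal_one]
      congr 1
      ext i
      fin_cases i <;> simp [hq.out.pow_eq_one])
    (by
      have h2 : (!![0, 1; 0, 0] : Matrix (Fin 2) (Fin 2) K) ^ 2 = 0 := by
        ext i j; fin_cases i <;> fin_cases j <;> simp [sq]
      exact pow_eq_zero_of_le hm h2)
    (by ext i j; fin_cases i <;> fin_cases j <;> simp [Matrix.mul_apply])

/-- The functional dual to `x` in the basis of the monomials `hᵃxᵇ`, as a matrix coefficient. -/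
def coeffX (hm : 2 ≤ m) : TaftAlgebra m q →ₗ[K] K :=
  Matrix.entryLinearMap K K 0 1 ∘ₗ (matrixRep q hm).toLinearMap

variable (hm : 2 ≤ m)

lemma coeffX_apply (a : TaftAlgebra m q) : coeffX q hm a = matrixRep q hm a 0 1 := rfl

lemma coeffX_one : coeffX q hm 1 = 0 := by simp [coeffX_apply]

lemma coeffX_h : coeffX q hm (h m q) = 0 := by simp [coeffX_apply, matrixRep]

lemma coeffX_x : coeffX q hm (x m q) = 1 := by simp [coeffX_apply, matrixRep]

include hm in
lemma x_ne_zero : x m q ≠ 0 := fun h0 => by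
  simpa [h0] using coeffX_x q hm

variable [NeZero m]

variable (m) in
/-- The character `h ↦ q`, `x ↦ 0`. -/
def character : TaftAlgebra m q →ₐ[K] K :=
  lift q 0 hq.out.pow_eq_one (zero_pow (NeZero.ne m)) (by simp)

lemma character_h : character m q (h m q) = q := lift_h _ _ _ _ _

lemma character_x : character m q (x m q) = 0 := lift_x _ _ _ _ _

lemma matrixRep_entries (a : TaftAlgebra m q) :
    matrixRep q hm a 1 0 = 0 ∧ matrixRep q hm a 0 0 = Bialgebra.counitAlgHom K _ a ∧
      matrixRep q hm a 1 1 = character m q a := by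
  have ha : a ∈ Algebra.adjoin K {h m q, x m q} := adjoin_eq_top m q ▸ Algebra.mem_top
  induction ha using Algebra.adjoin_induction with
  | mem a ha => obtain rfl | rfl := ha <;> simp [matrixRep, character]
  | algebraMap r => simp [Matrix.algebraMap_matrix_apply]
  | add a b _ _ iha ihb => simp [iha, ihb]
  | mul a b _ _ iha ihb => simp [Matrix.mul_apply, iha, ihb]

lemma coeffX_mul (a b : TaftAlgebra m q) : coeffX q hm (a * b) =
    Bialgebra.counitAlgHom K _ a * coeffX q hm b + coeffX q hm a * character m q b := by
  simp [coeffX_apply, Matrix.mul_apply, matrixRep_entries]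

variable (m) in
lemma isGroupLikeElem_h : IsGroupLikeElem K (h m q) := ⟨counit_h m q, comul_h m q⟩

variable (m) in
lemma isSkewPrimitive_x : IsSkewPrimitive K (h m q) 1 (x m q) := ⟨comul_x m q⟩

lemma sliceLeft_coeffX_mul (a b : TaftAlgebra m q) : sliceLeft (coeffX q hm) (a * b) =
    a * sliceLeft (coeffX q hm) b +
      sliceLeft (coeffX q hm) a * sliceLeft (character m q).toLinearMap b := by
  have h_counit : (Bialgebra.counitAlgHom K (TaftAlgebra m q)).toLinearMap = counit := rfl
  rw [sliceLeft_mul_of_skewDerivation (coeffX_mul q hm), h_counit, sliceLeft_counit,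
    LinearMap.id_apply]

lemma x_mul_eq_sliceLeft_character_mul_x (a : TaftAlgebra m q) :
    x m q * a = sliceLeft (character m q).toLinearMap a * x m q := by
  have ha : a ∈ Algebra.adjoin K {h m q, x m q} := adjoin_eq_top m q ▸ Algebra.mem_top
  induction ha using Algebra.adjoin_induction with
  | mem a ha =>
    obtain rfl | rfl := ha
    · rw [sliceLeft_groupLike _ (isGroupLikeElem_h m q), AlgHom.toLinearMap_apply, character_h,
        smul_mul_assoc, x_mul_h]
    · simp [(isSkewPrimitive_x m q).sliceLeft_eq, character_x]
  | algebraMap r =>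
    simp [Algebra.algebraMap_eq_smul_one, sliceLeft_groupLike _ (IsGroupLikeElem.one (R := K))]
  | add a b _ _ iha ihb => rw [mul_add, map_add, add_mul, iha, ihb]
  | mul a b _ _ iha ihb => rw [← mul_assoc, iha, mul_assoc, ihb, sliceLeft_algHom_mul, mul_assoc]

/-- The inner derivation `[·, h]` is, up to right multiplication by `x`, the action of the
functional dual to `x`. -/
lemma mul_h_sub_h_mul (a : TaftAlgebra m q) :
    a * h m q - h m q * a = (q - 1) • (sliceLeft (coeffX q hm) a * x m q) := by
  have ha : a ∈ Algebra.adjoin K {h m q, x m q} := adjoin_eq_top m q ▸ Algebra.mem_top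
  induction ha using Algebra.adjoin_induction with
  | mem a ha =>
    obtain rfl | rfl := ha
    · simp [sliceLeft_groupLike _ (isGroupLikeElem_h m q), coeffX_h]
    · simp [(isSkewPrimitive_x m q).sliceLeft_eq, coeffX_x, coeffX_one, x_mul_h, sub_smul]
  | algebraMap r =>
    simp [Algebra.algebraMap_eq_smul_one, sliceLeft_groupLike _ (IsGroupLikeElem.one (R := K)),
      coeffX_one]
  | add a b _ _ iha ihb =>
    rw [map_add, add_mul, add_mul, smul_add, ← iha, ← ihb, mul_add, add_sub_add_comm]
  | mul a b _ _ iha ihb =>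
    calc a * b * h m q - h m q * (a * b)
      _ = a * (b * h m q - h m q * b) + (a * h m q - h m q * a) * b := by noncomm_ring
      _ = (q - 1) • (sliceLeft (coeffX q hm) (a * b) * x m q) := by
        rw [ihb, iha, sliceLeft_coeffX_mul, add_mul, smul_add, mul_smul_comm, smul_mul_assoc,
          mul_assoc _ (x m q), x_mul_eq_sliceLeft_character_mul_x, ← mul_assoc, ← mul_assoc]

variable {q} {s t : TaftAlgebra m q}

lemma coeffX_mul_h (a : TaftAlgebra m q) : coeffX q hm (a * h m q) = q * coeffX q hm a := by
  simp [coeffX_mul, coeffX_h, character_h, mul_comm]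

lemma coeffX_h_mul (a : TaftAlgebra m q) : coeffX q hm (h m q * a) = coeffX q hm a := by
  simp [coeffX_mul, coeffX_h]

lemma coeffX_mul_x (a : TaftAlgebra m q) : coeffX q hm (a * x m q) = counit (R := K) a := by
  simp [coeffX_mul, coeffX_x, character_x]

lemma groupLike_mul_h_sub (ht : IsGroupLikeElem K t) :
    t * h m q - h m q * t = ((q - 1) * coeffX q hm t) • (t * x m q) := by
  rw [mul_h_sub_h_mul q hm, sliceLeft_groupLike _ ht, smul_mul_assoc, smul_smul]

lemma coeffX_groupLike (ht : IsGroupLikeElem K t) : coeffX q hm t = 0 := by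
  have hq1 : q - 1 ≠ 0 := sub_ne_zero.2 (hq.out.ne_one hm)
  have hχt : character m q t ≠ 0 := (ht.isUnit.map (character m q)).ne_zero
  have h_slice := congrArg (fun a => character m q (sliceRight (coeffX q hm) a))
    (groupLike_mul_h_sub hm ht)
  simp only [map_sub, map_smul, map_mul, map_add,
    sliceRight_groupLike _ (ht.mul (isGroupLikeElem_h m q)),
    sliceRight_groupLike _ ((isGroupLikeElem_h m q).mul ht),
    ((isSkewPrimitive_x m q).groupLike_mul ht).sliceRight_eq, coeffX_mul_h, coeffX_h_mul,
    coeffX_mul_x, ht.counit_eq_one, character_h, character_x, smul_eq_mul, mul_one,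
    mul_zero] at h_slice
  have h_zero : (q - 1) * (q - 1) * character m q t * coeffX q hm t = 0 := by
    linear_combination h_slice
  simpa [hq1, hχt] using h_zero

include hm in
lemma groupLike_mul_h (ht : IsGroupLikeElem K t) : t * h m q = h m q * t := by
  rw [← sub_eq_zero, groupLike_mul_h_sub hm ht, coeffX_groupLike hm ht, mul_zero, zero_smul]

lemma skewPrimitive_mul_h_sub (hs : IsSkewPrimitive K t 1 s) :
    s * h m q - h m q * s = ((q - 1) * coeffX q hm s) • (t * x m q) := by
  rw [mul_h_sub_h_mul q hm, hs.sliceLeft_eq, coeffX_one, zero_smul, add_zero, smul_mul_assoc,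
    smul_smul]

lemma eq_h_of_coeffX_ne_zero (ht : IsGroupLikeElem K t) (hs : IsSkewPrimitive K t 1 s)
    (h0 : coeffX q hm s ≠ 0) : t = h m q := by
  have hκ : (q - 1) * coeffX q hm s ≠ 0 := mul_ne_zero (sub_ne_zero.2 (hq.out.ne_one hm)) h0
  have h_slice := congrArg (sliceRight (coeffX q hm)) (skewPrimitive_mul_h_sub hm hs)
  rw [map_sub, map_smul, (hs.mul_groupLike (isGroupLikeElem_h m q)).sliceRight_eq,
    (hs.groupLike_mul (isGroupLikeElem_h m q)).sliceRight_eq,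
    ((isSkewPrimitive_x m q).groupLike_mul ht).sliceRight_eq, coeffX_mul_h, coeffX_mul_h,
    coeffX_h_mul, coeffX_h_mul, coeffX_mul_x, coeffX_groupLike hm ht, ht.counit_eq_one, mul_zero,
    zero_smul, zero_smul, zero_smul, zero_add, zero_add, zero_add, one_smul, one_mul, mul_one,
    mul_one, ← sub_smul, ← sub_one_mul] at h_slice
  exact (smul_right_injective _ hκ h_slice).symm

include hm in
lemma x_mul_h_ne : x m q * h m q ≠ h m q * x m q := fun h_comm => by
  have h_smul : (q - 1) • (h m q * x m q) = 0 := by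
    rw [sub_smul, one_smul, ← x_mul_h, h_comm, sub_self]
  rw [smul_eq_zero, (isGroupLikeElem_h m q).isUnit.mul_right_eq_zero] at h_smul
  exact h_smul.elim (sub_ne_zero.2 (hq.out.ne_one hm)) (x_ne_zero q hm)

include hm in
/-- If the `x`-component of `φ x` vanished, then `h` would commute with the image of `φ`. -/
lemma bialgHom_eq_of_surjective {φ : TaftAlgebra m q →ₐc[K] TaftAlgebra m q}
    (hφ : Function.Surjective φ) :
    φ (h m q) = h m q ∧ ∃ ω : K, φ (x m q) = ω • x m q := by
  have ht : IsGroupLikeElem K (φ (h m q)) := (isGroupLikeElem_h m q).map φ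
  have hs : IsSkewPrimitive K (φ (h m q)) 1 (φ (x m q)) := by
    simpa using (isSkewPrimitive_x m q).map (φ : TaftAlgebra m q →ₗc[K] TaftAlgebra m q)
  have h_sub := skewPrimitive_mul_h_sub hm hs
  have h0 : coeffX q hm (φ (x m q)) ≠ 0 := fun h0 => by
    have h_central (a : TaftAlgebra m q) : φ a * h m q = h m q * φ a := by
      have ha : a ∈ Algebra.adjoin K {h m q, x m q} := adjoin_eq_top m q ▸ Algebra.mem_top
      induction ha using Algebra.adjoin_induction with
      | mem a ha =>
        obtain rfl | rfl := ha
        · exact groupLike_mul_h hm ht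
        · rwa [h0, mul_zero, zero_smul, sub_eq_zero] at h_sub
      | algebraMap r => simp [Algebra.algebraMap_eq_smul_one]
      | add a b _ _ iha ihb => rw [map_add, add_mul, mul_add, iha, ihb]
      | mul a b _ _ iha ihb => rw [map_mul, mul_assoc, ihb, ← mul_assoc, iha, mul_assoc]
    obtain ⟨a, ha⟩ := hφ (x m q)
    exact x_mul_h_ne hm (ha ▸ h_central a)
  have hth : φ (h m q) = h m q := eq_h_of_coeffX_ne_zero hm ht hs h0
  refine ⟨hth, coeffX q hm (φ (x m q)), ?_⟩
  have h_rel : φ (x m q) * h m q = q • (h m q * φ (x m q)) := by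
    simpa [hth] using congrArg φ (x_mul_h m q)
  rw [h_rel, hth, ← one_smul K (h m q * φ (x m q)), smul_smul, mul_one, ← sub_smul, mul_smul]
    at h_sub
  have h_mul := smul_right_injective _ (sub_ne_zero.2 (hq.out.ne_one hm)) h_sub
  rw [← mul_smul_comm] at h_mul
  exact (isGroupLikeElem_h m q).isUnit.mul_left_cancel h_mul

end Coefficients

end TaftAlgebra

section FactorMap

open Coalgebra

variable {K A H E : Type*} [CommSemiring K] [Semiring A] [Semiring H] [Semiring E]
  [Bialgebra K A] [Bialgebra K H] [Bialgebra K E]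

/-- The morphism of coalgebras `A ⊗ H → E`, `a ⊗ y ↦ i(a) j(y)`, whose bijectivity expresses that
`E` factorizes through `A` and `H`. -/
def factorMap (i : A →ₐc[K] E) (j : H →ₐc[K] E) : A ⊗[K] H →ₗc[K] E :=
  (Bialgebra.mulCoalgHom K E).comp
    (Coalgebra.TensorProduct.map (i : A →ₗc[K] E) (j : H →ₗc[K] E))

@[simp]
lemma factorMap_tmul (i : A →ₐc[K] E) (j : H →ₐc[K] E) (a : A) (y : H) :
    factorMap i j (a ⊗ₜ y) = i a * j y := rfl

variable {i : A →ₐc[K] E} {j : H →ₐc[K] E}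

lemma injective_left_of_factorMap (hij : Function.Injective (factorMap i j)) :
    Function.Injective i := fun a a' haa => by
  have h_tmul : a ⊗ₜ[K] (1 : H) = a' ⊗ₜ 1 := hij (by simp [haa])
  simpa using congrArg (TensorProduct.rid K A ∘ (counit (R := K) (A := H)).lTensor A) h_tmul

lemma injective_right_of_factorMap (hij : Function.Injective (factorMap i j)) :
    Function.Injective j := fun y y' hyy => by
  have h_tmul : (1 : A) ⊗ₜ[K] y = 1 ⊗ₜ y' := hij (by simp [hyy])
  simpa using congrArg (TensorProduct.lid K H ∘ (counit (R := K) (A := A)).rTensor H) h_tmul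

/-- The functional `i(a) j(y) ↦ ε(a) f(y)` on a bialgebra that factorizes through `A` and `H`. -/
def factorFunctional (hij : Function.Bijective (factorMap i j)) (f : H →ₗ[K] K) : E →ₗ[K] K :=
  LinearMap.mul' K K ∘ₗ TensorProduct.map counit f ∘ₗ
    (CoalgEquiv.ofBijective hij).symm.toLinearEquiv.toLinearMap

variable (hij : Function.Bijective (factorMap i j)) (f : H →ₗ[K] K)

lemma factorFunctional_comp_factorMap :
    factorFunctional hij f ∘ₗ (factorMap i j : A ⊗[K] H →ₗ[K] E) =
      LinearMap.mul' K K ∘ₗ TensorProduct.map counit f := by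
  have h_symm (w : A ⊗[K] H) : (CoalgEquiv.ofBijective hij).symm (factorMap i j w) = w :=
    (CoalgEquiv.ofBijective hij).symm_apply_apply w
  ext a y
  simp only [factorFunctional, TensorProduct.AlgebraTensorModule.curry_apply,
    LinearMap.restrictScalars_self, TensorProduct.curry_apply, LinearMap.comp_apply]
  exact congrArg (LinearMap.mul' K K ∘ TensorProduct.map counit f) (h_symm (a ⊗ₜ y))

lemma factorFunctional_mul (a : A) (y : H) :
    factorFunctional hij f (i a * j y) = counit (R := K) a * f y :=
  LinearMap.congr_fun (factorFunctional_comp_factorMap hij f) (a ⊗ₜ y)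

lemma sliceLeft_factorFunctional (w : A ⊗[K] H) :
    sliceLeft (factorFunctional hij f) (factorMap i j w) =
      factorMap i j ((sliceLeft f).lTensor A w) := by
  rw [sliceLeft_coalgHom_apply, factorFunctional_comp_factorMap, sliceLeft_mul'_map,
    sliceLeft_counit, LinearMap.lTensor]

lemma sliceRight_factorFunctional (w : A ⊗[K] H) :
    sliceRight (factorFunctional hij f) (factorMap i j w) =
      factorMap i j ((sliceRight f).lTensor A w) := by
  rw [sliceRight_coalgHom_apply, factorFunctional_comp_factorMap, sliceRight_mul'_map,
    sliceRight_counit, LinearMap.lTensor]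

lemma sliceLeft_factorFunctional_eq_sliceRight [IsCocomm K H] :
    sliceLeft (factorFunctional hij f) = sliceRight (factorFunctional hij f) := by
  ext e
  obtain ⟨w, rfl⟩ := hij.2 e
  rw [sliceLeft_factorFunctional, sliceRight_factorFunctional, sliceLeft_eq_sliceRight_of_isCocomm]

end FactorMap

section GroupAlgebra

variable {K G : Type*} [CommSemiring K]

variable (K) in
/-- The coefficient of `g` in an element of the group algebra. -/
def groupCoeff (g : G) : MonoidAlgebra K G →ₗ[K] K :=
  Finsupp.lapply g ∘ₗ (MonoidAlgebra.coeffLinearEquiv K).toLinearMap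

lemma groupCoeff_single (g : G) : groupCoeff K g (MonoidAlgebra.single g 1) = 1 := by
  simp [groupCoeff]

lemma sliceLeft_groupCoeff (g : G) (y : MonoidAlgebra K G) :
    sliceLeft (groupCoeff K g) y = groupCoeff K g y • MonoidAlgebra.single g 1 := by
  induction y using MonoidAlgebra.induction_linear with
  | zero => simp
  | add y y' hy hy' => rw [map_add, map_add, hy, hy', add_smul]
  | single g' r =>
    by_cases hg : g' = g
    · simp [sliceLeft_apply, groupCoeff, hg]
    · simp [sliceLeft_apply, groupCoeff, hg]

end GroupAlgebra

section Conjugation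

open Coalgebra

variable {K A E : Type*} [Field K] [Ring A] [Ring E] [Bialgebra K A] [Bialgebra K E]
  {i : A →ₐc[K] E} {γ : E}

lemma exists_mul_eq_mul_of_adjoin_eq_top {s : Set A} (hs : Algebra.adjoin K s = ⊤)
    (h : ∀ c ∈ s, ∃ b, γ * i c = i b * γ) (a : A) : ∃ b, γ * i a = i b * γ := by
  have ha : a ∈ Algebra.adjoin K s := hs ▸ Algebra.mem_top
  induction ha using Algebra.adjoin_induction with
  | mem c hc => exact h c hc
  | algebraMap r => exact ⟨algebraMap K A r, by
      rw [← BialgHom.coe_toAlgHom, AlgHom.commutes, Algebra.commutes]⟩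
  | add a a' _ _ ha ha' =>
    obtain ⟨b, hb⟩ := ha
    obtain ⟨b', hb'⟩ := ha'
    exact ⟨b + b', by rw [map_add, map_add, mul_add, add_mul, hb, hb']⟩
  | mul a a' _ _ ha ha' =>
    obtain ⟨b, hb⟩ := ha
    obtain ⟨b', hb'⟩ := ha'
    exact ⟨b * b', by rw [map_mul, map_mul, ← mul_assoc, hb, mul_assoc, hb', mul_assoc]⟩

lemma exists_algHom_conj (hi : Function.Injective i) (hγ : IsUnit γ)
    (h : ∀ a, ∃ b, γ * i a = i b * γ) : ∃ φ : A →ₐ[K] A, ∀ a, γ * i a = i (φ a) * γ := by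
  choose φ hφ using h
  have h_unique {b b' : A} (hbb : i b * γ = i b' * γ) : b = b' := hi (hγ.mul_right_cancel hbb)
  refine ⟨.ofLinearMap ⟨⟨φ, fun a b => h_unique ?_⟩, fun r a => h_unique ?_⟩ (h_unique ?_)
    fun a b => h_unique ?_, hφ⟩
  · rw [← hφ, map_add, map_add, mul_add, add_mul, hφ, hφ]
  · rw [← hφ, map_smul, map_smul, mul_smul_comm, smul_mul_assoc, hφ, RingHom.id_apply]
  · exact (hφ 1).symm.trans (by rw [map_one, mul_one, one_mul])
  · change i (φ (a * b)) * γ = i (φ a * φ b) * γ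
    rw [← hφ, map_mul, map_mul, ← mul_assoc, hφ, mul_assoc, hφ, mul_assoc]

lemma exists_bialgHom_conj (hi : Function.Injective i) (hγ : IsUnit γ)
    (hγ' : IsGroupLikeElem K γ) (h : ∀ a, ∃ b, γ * i a = i b * γ) :
    ∃ φ : A →ₐc[K] A, ∀ a, γ * i a = i (φ a) * γ := by
  obtain ⟨φ, hφ⟩ := exists_algHom_conj hi hγ h
  refine ⟨.ofAlgHom φ ?_ ?_, hφ⟩
  · ext a
    have h_counit := congrArg (counit (R := K)) (hφ a)
    simpa [hγ'.counit_eq_one] using h_counit.symm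
  · ext a
    set ι := Algebra.TensorProduct.map (i : A →ₐ[K] E) (i : A →ₐ[K] E)
    have hι : Function.Injective ι := TensorProduct.map_injective_of_flat_flat _ _ hi hi
    have h_comul (b : A) : comul (R := K) (i b) = ι (comul b) :=
      (CoalgHomClass.map_comp_comul_apply i b).symm
    have h_conj (w : A ⊗[K] A) :
        γ ⊗ₜ γ * ι w = ι (Algebra.TensorProduct.map φ φ w) * γ ⊗ₜ[K] γ := by
      induction w with
      | zero => simp
      | tmul a b => simp [ι, hφ]
      | add w w' hw hw' => simp only [map_add, mul_add, add_mul, hw, hw']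
    have hγγ : IsUnit (γ ⊗ₜ[K] γ) :=
      hγ'.comul_eq_tmul_self ▸ hγ.map (Bialgebra.comulAlgHom K E)
    refine hι (hγγ.mul_right_cancel ?_)
    have h_conj_comul := congrArg (comul (R := K)) (hφ a)
    rwa [Bialgebra.comul_mul, Bialgebra.comul_mul, hγ'.comul_eq_tmul_self, h_comul, h_comul,
      h_conj] at h_conj_comul

end Conjugation

section GroupAlgebraFactor

open Coalgebra

variable {K G A E : Type*} [Field K] [Group G] [Ring A] [Ring E] [Bialgebra K A] [Bialgebra K E]
  {i : A →ₐc[K] E} {j : MonoidAlgebra K G →ₐc[K] E}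

lemma isUnit_map_single (j : MonoidAlgebra K G →ₐc[K] E) (g : G) :
    IsUnit (j (MonoidAlgebra.single g 1)) :=
  ((Group.isUnit g).map (MonoidAlgebra.of K G)).map j

lemma exists_eq_mul_of_mem_range (hij : Function.Bijective (factorMap i j)) (g : G) {e : E}
    (he : e ∈ LinearMap.range (sliceLeft (factorFunctional hij (groupCoeff K g)))) :
    ∃ a, e = i a * j (MonoidAlgebra.single g 1) := by
  obtain ⟨e, rfl⟩ := he
  obtain ⟨w, rfl⟩ := hij.2 e
  rw [sliceLeft_factorFunctional]
  induction w with
  | zero => exact ⟨0, by simp⟩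
  | tmul a y => exact ⟨groupCoeff K g y • a, by
      rw [LinearMap.lTensor_tmul, sliceLeft_groupCoeff, factorMap_tmul, map_smul, map_smul,
        mul_smul_comm, smul_mul_assoc]⟩
  | add w w' hw hw' =>
    obtain ⟨a, ha⟩ := hw
    obtain ⟨a', ha'⟩ := hw'
    exact ⟨a + a', by rw [map_add, map_add, ha, ha', map_add, add_mul]⟩

lemma eq_smul_one_sub_or_exists_conj (hij : Function.Bijective (factorMap i j)) (g : G)
    {u c : A} (hu : IsGroupLikeElem K u) (hc : IsSkewPrimitive K u 1 c) :
    (∃ κ : K, c = κ • (1 - u)) ∨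
      (∃ a, j (MonoidAlgebra.single g 1) * i u = i a * j (MonoidAlgebra.single g 1)) ∧
        ∃ a, j (MonoidAlgebra.single g 1) * i c = i a * j (MonoidAlgebra.single g 1) := by
  set γ := j (MonoidAlgebra.single g 1)
  have hγ_groupLike : IsGroupLikeElem K γ := (MonoidAlgebra.isGroupLikeElem_single_one g).map j
  have h_skew : IsSkewPrimitive K (γ * i u) γ (γ * i c) := by
    simpa using (hc.map (i : A →ₗc[K] E)).groupLike_mul hγ_groupLike
  have hγ_one : factorFunctional hij (groupCoeff K g) γ = 1 := by
    simpa [groupCoeff_single] using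
      factorFunctional_mul hij (groupCoeff K g) 1 (MonoidAlgebra.single g 1)
  rcases h_skew.eq_smul_sub_or_mem_range (sliceLeft_factorFunctional_eq_sliceRight hij _)
    (hγ_groupLike.mul (hu.map i)) hγ_one with h_eq | ⟨hu_mem, hc_mem⟩
  · refine .inl ⟨factorFunctional hij (groupCoeff K g) (γ * i c), ?_⟩
    have hγ_unit : IsUnit γ := isUnit_map_single j g
    apply injective_left_of_factorMap hij.1
    apply hγ_unit.mul_left_cancel
    rwa [map_smul, map_sub, map_one, mul_smul_comm, mul_sub, mul_one]
  · exact .inr ⟨exists_eq_mul_of_mem_range hij g hu_mem, exists_eq_mul_of_mem_range hij g hc_mem⟩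

end GroupAlgebraFactor

section TaftFactor

open Coalgebra

variable {K G E : Type*} [Field K] [Group G] [Ring E] [Bialgebra K E] {m : ℕ} [NeZero m] {q : K}
  [Fact (IsPrimitiveRoot q m)] {i : TaftAlgebra m q →ₐc[K] E} {j : MonoidAlgebra K G →ₐc[K] E}

namespace TaftAlgebra

lemma exists_conj_of_factorMap (hm : 2 ≤ m) (hij : Function.Bijective (factorMap i j)) (g : G)
    (a : TaftAlgebra m q) :
    ∃ b, j (MonoidAlgebra.single g 1) * i a = i b * j (MonoidAlgebra.single g 1) := by
  refine exists_mul_eq_mul_of_adjoin_eq_top (adjoin_eq_top m q) (fun c hc => ?_) a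
  rcases eq_smul_one_sub_or_exists_conj hij g (isGroupLikeElem_h m q) (isSkewPrimitive_x m q) with
    ⟨κ, hx⟩ | ⟨hh, hx⟩
  · have h_coeff := coeffX_x q hm
    simp [hx, coeffX_one, coeffX_h] at h_coeff
  · obtain rfl | rfl := hc
    exacts [hh, hx]

lemma conj_h_x_of_factorMap (hm : 2 ≤ m) (hij : Function.Bijective (factorMap i j)) (g : G) :
    j (MonoidAlgebra.single g 1) * i (h m q) = i (h m q) * j (MonoidAlgebra.single g 1) ∧
      ∃ ω : K, j (MonoidAlgebra.single g 1) * i (x m q) =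
        ω • (i (x m q) * j (MonoidAlgebra.single g 1)) := by
  have hi : Function.Injective i := injective_left_of_factorMap hij.1
  obtain ⟨φ, hφ⟩ := exists_bialgHom_conj hi (isUnit_map_single j g)
    ((MonoidAlgebra.isGroupLikeElem_single_one g).map j) (exists_conj_of_factorMap hm hij g)
  have h_mul_inv : j (MonoidAlgebra.single g 1) * j (MonoidAlgebra.single g⁻¹ 1) = 1 := by
    rw [← map_mul, MonoidAlgebra.single_mul_single, mul_inv_cancel, one_mul,
      ← MonoidAlgebra.one_def, map_one]
  have hφ_surj : Function.Surjective φ := fun a => by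
    obtain ⟨b, hb⟩ := exists_conj_of_factorMap hm hij g⁻¹ a
    refine ⟨b, hi ?_⟩
    rw [← mul_one (i (φ b)), ← h_mul_inv, ← mul_assoc, ← hφ, mul_assoc, ← hb, ← mul_assoc,
      h_mul_inv, one_mul]
  obtain ⟨hφh, ω, hφx⟩ := bialgHom_eq_of_surjective hm hφ_surj
  exact ⟨by rw [hφ, hφh], ω, by rw [hφ, hφx, map_smul, smul_mul_assoc]⟩

lemma pow_eq_one_of_pow_mul_x (hm : 2 ≤ m) (hi : Function.Injective i) {γ : E} {ω : K}
    (hγx : γ * i (x m q) = ω • (i (x m q) * γ)) {n : ℕ} (hγ : γ ^ n = 1) : ω ^ n = 1 := by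
  have h_pow (k : ℕ) : γ ^ k * i (x m q) = ω ^ k • (i (x m q) * γ ^ k) := by
    induction k with
    | zero => simp
    | succ k ih =>
      rw [pow_succ, mul_assoc, hγx, mul_smul_comm, ← mul_assoc, ih, smul_mul_assoc, smul_smul,
        mul_assoc, ← pow_succ, ← pow_succ']
  have hx : i (x m q) ≠ 0 := (map_ne_zero_iff i hi).2 (x_ne_zero q hm)
  have h_smul : ω ^ n • i (x m q) = (1 : K) • i (x m q) := by
    simpa [hγ] using (h_pow n).symm
  exact smul_left_injective K hx h_smul

end TaftAlgebra

end TaftFactor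

section CyclicGroup

variable (K : Type*) [CommSemiring K] (n : ℕ)

/-- The generator of the cyclic group `Cₙ`, as an element of the group algebra `K[Cₙ]`. -/
def cyclicGen : MonoidAlgebra K (Multiplicative (ZMod n)) :=
  MonoidAlgebra.single (Multiplicative.ofAdd 1) 1

lemma isGroupLikeElem_cyclicGen : IsGroupLikeElem K (cyclicGen K n) :=
  MonoidAlgebra.isGroupLikeElem_single_one _

lemma cyclicGen_pow (k : ℕ) :
    cyclicGen K n ^ k = MonoidAlgebra.single (Multiplicative.ofAdd (k : ZMod n)) 1 := by
  rw [cyclicGen, MonoidAlgebra.single_pow, one_pow, ← ofAdd_nsmul, nsmul_one]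

lemma cyclicGen_pow_self : cyclicGen K n ^ n = 1 := by
  rw [cyclicGen_pow, ZMod.natCast_self, ofAdd_zero, MonoidAlgebra.one_def]

variable [NeZero n]

lemma single_eq_cyclicGen_pow (z : Multiplicative (ZMod n)) :
    MonoidAlgebra.single z 1 = cyclicGen K n ^ z.toAdd.val := by
  rw [cyclicGen_pow, ZMod.natCast_zmod_val, ofAdd_toAdd]

variable {K n} {B : Type*} [Semiring B] [Algebra K B]

lemma cyclicGen_algHom_ext {f f' : MonoidAlgebra K (Multiplicative (ZMod n)) →ₐ[K] B}
    (hf : f (cyclicGen K n) = f' (cyclicGen K n)) : f = f' :=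
  (MonoidAlgebra.lift K B _).symm.injective <| MonoidHom.ext fun z => by
    simp [single_eq_cyclicGen_pow, hf]

/-- The algebra homomorphism `K[Cₙ] → B` that sends the generator to a given `n`-th root of `1`. -/
def cyclicLift (c : B) (hc : c ^ n = 1) : MonoidAlgebra K (Multiplicative (ZMod n)) →ₐ[K] B :=
  MonoidAlgebra.lift K B (Multiplicative (ZMod n))
    { toFun := fun z => c ^ z.toAdd.val
      map_one' := by simp
      map_mul' := fun z w => by rw [toAdd_mul, ZMod.val_add, ← pow_add, ← pow_eq_pow_mod _ hc] }

lemma cyclicLift_gen (c : B) (hc : c ^ n = 1) : cyclicLift c hc (cyclicGen K n) = c := by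
  have h_val : cyclicLift c hc (cyclicGen K n) = c ^ (1 : ZMod n).val := by
    simp [cyclicLift, cyclicGen]
  rw [h_val, ZMod.val_one_eq_one_mod, ← pow_eq_pow_mod _ hc, pow_one]

end CyclicGroup

lemma submodule_eq_top_of_adjoin_eq_top {K A : Type*} [CommSemiring K] [Semiring A] [Algebra K A]
    {s : Set A} (hs : Algebra.adjoin K s = ⊤) (M : Submodule K A) (h_one : 1 ∈ M)
    (h_mul : ∀ a ∈ s, ∀ y ∈ M, a * y ∈ M) : M = ⊤ := by
  have h_stable (a : A) : ∀ y ∈ M, a * y ∈ M := by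
    have ha : a ∈ Algebra.adjoin K s := hs ▸ Algebra.mem_top
    induction ha using Algebra.adjoin_induction with
    | mem a ha => exact h_mul a ha
    | algebraMap r => intro y hy; rw [← Algebra.smul_def]; exact M.smul_mem r hy
    | add a b _ _ iha ihb => intro y hy; rw [add_mul]; exact M.add_mem (iha y hy) (ihb y hy)
    | mul a b _ _ iha ihb => intro y hy; rw [mul_assoc]; exact iha _ (ihb y hy)
  exact eq_top_iff.2 fun a _ => by simpa using h_stable a 1 h_one

lemma toEnd_mul_lmul {K A : Type*} [CommSemiring K] [Semiring A] [Algebra K A] (φ : A →ₐ[K] A)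
    (a : A) : φ.toEnd * Algebra.lmul K A a = Algebra.lmul K A (φ a) * φ.toEnd := by
  ext b
  exact map_mul φ a b

namespace TaftAlgebra

variable {K : Type*} [Field K] (m : ℕ) (q : K)

/-- The action of the multiplicative monoid `K` on the Taft algebra by `ω ↦ (h ↦ h, x ↦ ωx)`. -/
def twist : K →* (TaftAlgebra m q →ₐ[K] TaftAlgebra m q) where
  toFun ω := lift (h m q) (ω • x m q) (h_pow m q)
    (by rw [smul_pow, x_pow, smul_zero])
    (by rw [smul_mul_assoc, x_mul_h, mul_smul_comm, smul_comm])
  map_one' := by apply algHom_ext <;> simp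
  map_mul' ω ω' := by apply algHom_ext <;> simp [smul_smul, mul_comm ω]

variable (ω : K)

@[simp]
lemma twist_h : twist m q ω (h m q) = h m q := by simp [twist]

@[simp]
lemma twist_x : twist m q ω (x m q) = ω • x m q := by simp [twist]

end TaftAlgebra

namespace ExtTaftAlgebra

open TaftAlgebra (twist)

variable {K : Type*} [Field K] (n m : ℕ) (q ω : K)

section TensorRep

variable {n ω}

/-- The representation of `T^ω_{nm²}(q)` by left multiplications on the smash product of the Taft
algebra and `K[Cₙ]`, where `g` acts as the twist by `ω` on the first factor. -/
def tensorRep (hω : ω ^ n = 1) : ExtTaftAlgebra n m q ω →ₐ[K]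
    Module.End K (TaftAlgebra m q) ⊗[K] MonoidAlgebra K (Multiplicative (ZMod n)) :=
  lift ((twist m q ω).toEnd ⊗ₜ[K] cyclicGen K n)
    (Algebra.TensorProduct.includeLeft (Algebra.lmul K _ (TaftAlgebra.h m q)))
    (Algebra.TensorProduct.includeLeft (Algebra.lmul K _ (TaftAlgebra.x m q)))
    (by rw [Algebra.TensorProduct.tmul_pow, ← map_pow, ← map_pow, hω, map_one, map_one,
      cyclicGen_pow_self, Algebra.TensorProduct.one_def])
    (by rw [← map_pow, ← map_pow, TaftAlgebra.h_pow, map_one, map_one])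
    (by rw [← map_pow, ← map_pow, TaftAlgebra.x_pow, map_zero, map_zero])
    (by rw [← map_mul, ← map_mul, TaftAlgebra.x_mul_h, map_smul, map_smul, map_mul, map_mul])
    (by rw [Algebra.TensorProduct.includeLeft_apply, Algebra.TensorProduct.tmul_mul_tmul,
      Algebra.TensorProduct.tmul_mul_tmul, toEnd_mul_lmul, TaftAlgebra.twist_h, one_mul, mul_one])
    (by rw [Algebra.TensorProduct.includeLeft_apply, Algebra.TensorProduct.tmul_mul_tmul,
      Algebra.TensorProduct.tmul_mul_tmul, toEnd_mul_lmul, TaftAlgebra.twist_x, one_mul, mul_one,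
      map_smul, smul_mul_assoc, TensorProduct.smul_tmul'])

variable (hω : ω ^ n = 1)

lemma tensorRep_g : tensorRep m q hω (g n m q ω) = (twist m q ω).toEnd ⊗ₜ cyclicGen K n :=
  lift_g ..

lemma tensorRep_h : tensorRep m q hω (h n m q ω) = Algebra.lmul K _ (TaftAlgebra.h m q) ⊗ₜ 1 :=
  lift_h ..

lemma tensorRep_x : tensorRep m q hω (x n m q ω) = Algebra.lmul K _ (TaftAlgebra.x m q) ⊗ₜ 1 :=
  lift_x ..

end TensorRep

variable [NeZero m] [Fact (IsPrimitiveRoot q m)]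

/-- The embedding `T_{m²}(q) → T^ω_{nm²}(q)`. -/
def ofTaft : TaftAlgebra m q →ₐc[K] ExtTaftAlgebra n m q ω :=
  .ofAlgHom (TaftAlgebra.lift (h n m q ω) (x n m q ω) (h_pow n m q ω) (x_pow n m q ω)
      (x_mul_h n m q ω))
    (by apply TaftAlgebra.algHom_ext <;> simp)
    (by apply TaftAlgebra.algHom_ext <;> simp)

@[simp]
lemma ofTaft_h : ofTaft n m q ω (TaftAlgebra.h m q) = h n m q ω := TaftAlgebra.lift_h ..

@[simp]
lemma ofTaft_x : ofTaft n m q ω (TaftAlgebra.x m q) = x n m q ω := TaftAlgebra.lift_x ..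

lemma exists_g_mul_ofTaft (a : TaftAlgebra m q) :
    ∃ b, g n m q ω * ofTaft n m q ω a = ofTaft n m q ω b * g n m q ω := by
  refine exists_mul_eq_mul_of_adjoin_eq_top (TaftAlgebra.adjoin_eq_top m q) (fun c hc => ?_) a
  obtain rfl | rfl := hc
  · exact ⟨TaftAlgebra.h m q, by simp [h_mul_g]⟩
  · exact ⟨ω • TaftAlgebra.x m q, by simp [g_mul_x]⟩

lemma tensorRep_ofTaft (hω : ω ^ n = 1) (a : TaftAlgebra m q) :
    tensorRep m q hω (ofTaft n m q ω a) = Algebra.lmul K _ a ⊗ₜ 1 := by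
  have h_comp : (tensorRep m q hω).comp (ofTaft n m q ω : TaftAlgebra m q →ₐ[K] _) =
      (Algebra.TensorProduct.includeLeft : Module.End K (TaftAlgebra m q) →ₐ[K] _).comp
        (Algebra.lmul K (TaftAlgebra m q)) := by
    apply TaftAlgebra.algHom_ext
    · simp [tensorRep_h]
    · simp [tensorRep_x]
  exact AlgHom.congr_fun h_comp a

variable [NeZero n]

/-- The embedding `K[Cₙ] → T^ω_{nm²}(q)`. -/
def ofCyclic : MonoidAlgebra K (Multiplicative (ZMod n)) →ₐc[K] ExtTaftAlgebra n m q ω :=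
  .ofAlgHom (cyclicLift (g n m q ω) (g_pow n m q ω))
    (cyclicGen_algHom_ext (by
      simp [cyclicLift_gen, (isGroupLikeElem_cyclicGen K n).counit_eq_one]))
    (cyclicGen_algHom_ext (by
      simp [cyclicLift_gen, (isGroupLikeElem_cyclicGen K n).comul_eq_tmul_self]))

@[simp]
lemma ofCyclic_gen : ofCyclic n m q ω (cyclicGen K n) = g n m q ω :=
  cyclicLift_gen (g n m q ω) (g_pow n m q ω)

lemma tensorRep_ofCyclic (hω : ω ^ n = 1) (z : Multiplicative (ZMod n)) :
    tensorRep m q hω (ofCyclic n m q ω (MonoidAlgebra.single z 1)) =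
      (twist m q (ω ^ z.toAdd.val)).toEnd ⊗ₜ MonoidAlgebra.single z 1 := by
  rw [single_eq_cyclicGen_pow, map_pow, ofCyclic_gen, map_pow, tensorRep_g,
    Algebra.TensorProduct.tmul_pow, map_pow, map_pow]

lemma factorMap_injective (hω : ω ^ n = 1) :
    Function.Injective (factorMap (ofTaft n m q ω) (ofCyclic n m q ω)) := by
  let evalOne := (LinearMap.applyₗ (R := K) (M₂ := TaftAlgebra m q) (1 : TaftAlgebra m q)).rTensor
    (MonoidAlgebra K (Multiplicative (ZMod n)))
  have h_left_inv : evalOne ∘ₗ (tensorRep m q hω).toLinearMap ∘ₗ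
      (factorMap (ofTaft n m q ω) (ofCyclic n m q ω)).toLinearMap = .id := by
    ext a z : 4
    simp [evalOne, tensorRep_ofTaft, tensorRep_ofCyclic]
  exact Function.LeftInverse.injective (g := evalOne ∘ tensorRep m q hω)
    (LinearMap.congr_fun h_left_inv)

lemma factorMap_surjective :
    Function.Surjective (factorMap (ofTaft n m q ω) (ofCyclic n m q ω)) := by
  suffices h_top : LinearMap.range
      (factorMap (ofTaft n m q ω) (ofCyclic n m q ω)).toLinearMap = ⊤ from
    LinearMap.range_eq_top.1 h_top
  refine submodule_eq_top_of_adjoin_eq_top (adjoin_eq_top n m q ω) _ ⟨1 ⊗ₜ 1, by simp⟩ ?_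
  rintro a ha _ ⟨w, rfl⟩
  induction w with
  | zero => simp
  | add w w' hw hw' => rw [map_add, mul_add]; exact Submodule.add_mem _ hw hw'
  | tmul t y =>
    obtain rfl | rfl | rfl := ha
    · obtain ⟨b, hb⟩ := exists_g_mul_ofTaft n m q ω t
      refine ⟨b ⊗ₜ (cyclicGen K n * y), ?_⟩
      simp [← mul_assoc, hb]
    · exact ⟨(TaftAlgebra.h m q * t) ⊗ₜ y, by simp [mul_assoc]⟩
    · exact ⟨(TaftAlgebra.x m q * t) ⊗ₜ y, by simp [mul_assoc]⟩

lemma factorMap_bijective (hω : ω ^ n = 1) :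
    Function.Bijective (factorMap (ofTaft n m q ω) (ofCyclic n m q ω)) :=
  ⟨factorMap_injective n m q ω hω, factorMap_surjective n m q ω⟩

end ExtTaftAlgebra

section Factorization

section Transport

variable {K E F A H : Type*} [CommSemiring K] [Semiring E] [Bialgebra K E] [Semiring F]
  [Bialgebra K F] [Semiring A] [Bialgebra K A] [Semiring H] [Bialgebra K H]
  (i : A →ₐc[K] E) (j : H →ₐc[K] E)

lemma factorMap_comp (f : E →ₐc[K] F) :
    factorMap (f.comp i) (f.comp j) = (f : E →ₗc[K] F).comp (factorMap i j) := by
  ext w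
  induction w with
  | zero => simp
  | tmul a y => simp
  | add w w' hw hw' => rw [map_add, map_add, hw, hw']

end Transport

lemma factorizesThrough_iff {K E A H : Type*} [Field K] [Ring E] [HopfAlgebra K E] [Ring A]
    [HopfAlgebra K A] [Ring H] [HopfAlgebra K H] :
    FactorizesThrough K E A H ↔
      ∃ (i : A →ₐc[K] E) (j : H →ₐc[K] E), Function.Bijective (factorMap i j) :=
  ⟨fun ⟨i, j, _, _, hij⟩ => ⟨i, j, hij⟩, fun ⟨i, j, hij⟩ =>
    ⟨i, j, injective_left_of_factorMap hij.1, injective_right_of_factorMap hij.1, hij⟩⟩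

namespace ExtTaftAlgebra

variable {K E : Type*} [Field K] [Ring E] [Bialgebra K E] {n m : ℕ} [NeZero m]
  {q ω : K} [Fact (IsPrimitiveRoot q m)]
  {i : TaftAlgebra m q →ₐc[K] E} {j : MonoidAlgebra K (Multiplicative (ZMod n)) →ₐc[K] E}

lemma exists_relations_of_factorMap (hij : Function.Bijective (factorMap i j)) :
    ∃ ω : K, ω ^ n = 1 ∧
      i (TaftAlgebra.h m q) * j (cyclicGen K n) = j (cyclicGen K n) * i (TaftAlgebra.h m q) ∧
      j (cyclicGen K n) * i (TaftAlgebra.x m q) =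
        ω • (i (TaftAlgebra.x m q) * j (cyclicGen K n)) := by
  obtain rfl | hm : m = 1 ∨ 2 ≤ m := by have := NeZero.ne m; omega
  · have hh : TaftAlgebra.h 1 q = 1 := by simpa using TaftAlgebra.h_pow 1 q
    have hx : TaftAlgebra.x 1 q = 0 := by simpa using TaftAlgebra.x_pow 1 q
    exact ⟨1, by simp [hh, hx]⟩
  · obtain ⟨hγh, ω, hγx⟩ := TaftAlgebra.conj_h_x_of_factorMap hm hij (Multiplicative.ofAdd 1)
    have hγ : j (cyclicGen K n) ^ n = 1 := by rw [← map_pow, cyclicGen_pow_self, map_one]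
    exact ⟨ω, TaftAlgebra.pow_eq_one_of_pow_mul_x hm (injective_left_of_factorMap hij.1) hγx hγ,
      hγh.symm, hγx⟩

section Lift

variable (hhg : i (TaftAlgebra.h m q) * j (cyclicGen K n) =
    j (cyclicGen K n) * i (TaftAlgebra.h m q))
  (hgx : j (cyclicGen K n) * i (TaftAlgebra.x m q) =
    ω • (i (TaftAlgebra.x m q) * j (cyclicGen K n)))

/-- The bialgebra homomorphism `T^ω_{nm²}(q) → E` that extends homomorphisms from `T_{m²}(q)` and
`K[Cₙ]` whose values satisfy the commutation relations of `T^ω_{nm²}(q)`. -/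
def liftFactors : ExtTaftAlgebra n m q ω →ₐc[K] E :=
  .ofAlgHom
    (lift (j (cyclicGen K n)) (i (TaftAlgebra.h m q)) (i (TaftAlgebra.x m q))
      (by rw [← map_pow, cyclicGen_pow_self, map_one])
      (by rw [← map_pow, TaftAlgebra.h_pow, map_one])
      (by rw [← map_pow, TaftAlgebra.x_pow, map_zero])
      (by rw [← map_mul, TaftAlgebra.x_mul_h, map_smul, map_mul]) hhg hgx)
    (by
      apply algHom_ext
      · simp [(isGroupLikeElem_cyclicGen K n).counit_eq_one]
      · simp
      · simp)
    (by
      apply algHom_ext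
      · simp [← CoalgHomClass.map_comp_comul_apply,
          (isGroupLikeElem_cyclicGen K n).comul_eq_tmul_self]
      · simp [← CoalgHomClass.map_comp_comul_apply]
      · simp [← CoalgHomClass.map_comp_comul_apply])

lemma liftFactors_g : liftFactors hhg hgx (g n m q ω) = j (cyclicGen K n) := lift_g ..

lemma liftFactors_h : liftFactors hhg hgx (h n m q ω) = i (TaftAlgebra.h m q) := lift_h ..

lemma liftFactors_x : liftFactors hhg hgx (x n m q ω) = i (TaftAlgebra.x m q) := lift_x ..

lemma liftFactors_comp_ofTaft : (liftFactors hhg hgx).comp (ofTaft n m q ω) = i := by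
  have h_eq : ((liftFactors hhg hgx).comp (ofTaft n m q ω) : TaftAlgebra m q →ₐ[K] E) = i := by
    apply TaftAlgebra.algHom_ext
    · simp [liftFactors_h]
    · simp [liftFactors_x]
  exact BialgHom.ext fun a => AlgHom.congr_fun h_eq a

variable [NeZero n]

lemma liftFactors_comp_ofCyclic : (liftFactors hhg hgx).comp (ofCyclic n m q ω) = j := by
  have h_eq : ((liftFactors hhg hgx).comp (ofCyclic n m q ω) :
      MonoidAlgebra K (Multiplicative (ZMod n)) →ₐ[K] E) = j :=
    cyclicGen_algHom_ext (by simp [liftFactors_g])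
  exact BialgHom.ext fun y => AlgHom.congr_fun h_eq y

lemma liftFactors_bijective (hω : ω ^ n = 1) (hij : Function.Bijective (factorMap i j)) :
    Function.Bijective (liftFactors hhg hgx) := by
  have h_comp : factorMap i j = (liftFactors hhg hgx : ExtTaftAlgebra n m q ω →ₗc[K] E).comp
      (factorMap (ofTaft n m q ω) (ofCyclic n m q ω)) := by
    rw [← factorMap_comp, liftFactors_comp_ofTaft, liftFactors_comp_ofCyclic]
  rw [h_comp] at hij
  exact (Function.Bijective.of_comp_iff _ (factorMap_bijective n m q ω hω)).1 hij

end Lift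

end ExtTaftAlgebra

theorem corollary3p2_general {K E : Type*} [Field K] [Ring E] [HopfAlgebra K E]
    (n m : ℕ) [NeZero n] [NeZero m] (q : K) [Fact (IsPrimitiveRoot q m)] :
    FactorizesThrough K E (TaftAlgebra m q) (MonoidAlgebra K (Multiplicative (ZMod n))) ↔
      ∃ ω : K, ω ^ n = 1 ∧ Nonempty (E ≃ₐc[K] ExtTaftAlgebra n m q ω) := by
  constructor
  · rw [factorizesThrough_iff]
    rintro ⟨i, j, hij⟩
    obtain ⟨ω, hω, hhg, hgx⟩ := ExtTaftAlgebra.exists_relations_of_factorMap hij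
    have h_bij := ExtTaftAlgebra.liftFactors_bijective hhg hgx hω hij
    exact ⟨ω, hω, ⟨(BialgEquiv.ofBijective _ h_bij).symm⟩⟩
  · rintro ⟨ω, hω, ⟨e⟩⟩
    refine factorizesThrough_iff.2 ⟨(e.symm : _ →ₐc[K] E).comp (ExtTaftAlgebra.ofTaft n m q ω),
      (e.symm : _ →ₐc[K] E).comp (ExtTaftAlgebra.ofCyclic n m q ω), ?_⟩
    rw [factorMap_comp]
    exact e.symm.bijective.comp (ExtTaftAlgebra.factorMap_bijective n m q ω hω)

end Factorization

end

theorem corollary3p2 {K E : Type*} [Field K] [Ring E] [HopfAlgebra K E]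
    (n m : ℕ) [NeZero n] [NeZero m] (hn : 2 ≤ n) (hm : 3 ≤ m)
    (q : K) [Fact (IsPrimitiveRoot q m)] :
    FactorizesThrough K E (TaftAlgebra m q) (MonoidAlgebra K (Multiplicative (ZMod n))) ↔
      ∃ ω : K, ω ^ n = 1 ∧ Nonempty (E ≃ₐc[K] ExtTaftAlgebra n m q ω) :=
  corollary3p2_general n m q
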